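/- **Setting.** Fix $L>0$ and an integer $L_0\ge 1$; put $L_N=2^NL_0$, $\varepsilon_N=L/L_N$, $\Lambda_N=\varepsilon_N\{-L_N,\dots,L_N-1\}$ ($N\in\mathbb N_0$). Choose periodic ($+$, Ramond) or anti-periodic ($-$, Neveu–Schwarz) boundary conditions, i.e. lattice and continuum fields are extended by $f(x+2L)=\pm f(x)$. Let $\mathfrak h_N=\ell^2(\Lambda_N)\otimes\mathbb C^2$ and $\mathfrak h_\infty=L^2((-L,L])\otimes\mathbb C^2$. The momenta are $\Gamma_\infty=\frac{\pi}{L}(\mathbb Z+\theta)$ and $\Gamma_N=\frac{\pi}{L}(\{-L_N,\dots,L_N-1\}+\theta)$, with $\theta=0$ for $+$ and $\theta=\frac12$ for $-$; $e_{k,j}$ is the plane wave $e^{ikx}$ in the $j$-th component. The charge conjugation is $C\xi=\sigma_z\overline\xi$. Let $s\in L^2(\mathbb R)$ be a compactly supported orthonormal scaling function: its integer translates are orthonormal, $\int s=1$, and $s(x)=\sum_n h_n\sqrt2\,s(2x-n)$ with a finite filter $(h_n)$. Componentwise, let $R^N_{N+1}\xi=\sum_{x\in\Lambda_N}\xi_x\sum_{n\in\mathbb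 Z}h_n\,\delta_{x+\varepsilon_{N+1}n}$, with $\delta_{x+2L}=\pm\delta_x$, and $R^N_\infty\xi=\sum_{x\in\Lambda_N}\xi_x\sum_{m\in\mathbb Z}(\pm1)^m\varepsilon_N^{-1/2}s(\varepsilon_N^{-1}(\cdot-x+2Lm))$. These are isometries. Put $R^N_{N+M}=R^{N+M-1}_{N+M}\cdots R^N_{N+1}$. Let $\mathfrak A_N$ be the CAR algebra of $\mathfrak h_N$, $N\le\infty$: the universal unital $C^*$-algebra generated by anti-linear $a(\xi)$ with $\{a(\xi),a(\eta)^*\}=\langle\xi,\eta\rangle$, $\{a(\xi),a(\eta)\}=0$. Let $\mathfrak B_N$ be the self-dual CAR algebra of $(\mathfrak h_N,C)$: the universal unital $C^*$-algebra generated by anti-linear $\Psi(\xi)$ with $\{\Psi(\xi),\Psi(\eta)\}=\langle\xi,C\eta\rangle$, $\Psi(\xi)^*=\Psi(C\xi)$. Let $\alpha^N_{N+M}$ and $\alpha^N_\infty$ be the unital $*$-homomorphisms $a(\xi)\mapsto a(R\xi)$, respectively $\Psi(\xi)\mapsto\Psi(R\xi)$; on $\mathfrak B_N$ we assume $s$ real-valued,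 so that $R$ commutes with $C$. For $0\le S\le1$, the quasi-free state $\omega_S$ is the state with $$\omega_S(a(\xi_n)\cdots a(\xi_1)a(\eta_1)^*\cdots a(\eta_m)^*)=\delta_{nm}\det(\langle\xi_i,(1-S)\eta_j\rangle)_{i,j},$$ respectively, when $CS=(1-S)C$, $$\omega_S(\Psi(\xi_1)\cdots\Psi(\xi_n))=\mathrm{pf}(\langle\xi_i,(1-S)C\xi_j\rangle)_{i,j},$$ where the Pfaffian is formed from the entries with $i<j$ and vanishes for odd $n$. **Lemma.** For every $N$ let $\omega^{(N)}$ be the quasi-free state on $\mathfrak A_N$ (respectively $\mathfrak B_N$) of an operator $0\le S^{(N)}\le1$ on $\mathfrak h_N$ (respectively, with also $CS^{(N)}=(1-S^{(N)})C$) that is diagonal in momentum space: $\langle e_{k,i},S^{(N)}e_{l,j}\rangle=2L_N\delta_{k,l}S^{(N)}(k)_{ij}$ for $k,l\in\Gamma_N$. Let $0\le S\le1$ on $\mathfrak h_\infty$ (respectively, with also $CS=(1-S)C$) satisfy $\langle e_{k,i},Se_{l,j}\rangle=2L\delta_{k,l}S(k)_{ij}$ for $k,l\in\Gamma_\infty$,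 and let $\omega_S$ be its quasi-free state. Suppose that $S^{(N)}(k)_{ij}\to S(k)_{ij}$ as $N\to\infty$ for all $k\in\Gamma_\infty$ and $i,j\in\{1,2\}$ (each $k$ lies in $\Gamma_N$ for all large $N$). Then, for every $N$, the renormalization group flow $\omega^{(N)}_M=\omega^{(N+M)}\circ\alpha^N_{N+M}$ satisfies $$\lim_{M\to\infty}\|\omega^{(N)}_M-\omega_S\circ\alpha^N_\infty\|=0 .$$ **Corollary.** Let $\lambda_N\ge0$ with $\lambda_N/\varepsilon_N\to m\ge0$. If $m=0$ and the boundary conditions are periodic, assume also that $\lambda_N=0$ for all large $N$. Put $$h_N(k)=(\cos\varepsilon_Nk-1)\sigma_x+\sin(\varepsilon_Nk)\sigma_y+\lambda_N\sigma_\bullet,\qquad h_\infty(k)=k\sigma_y+m\sigma_\bullet,$$ where $\sigma_\bullet=\sigma_z$ (Dirac mass) or $\sigma_\bullet=\sigma_x$ (Majorana mass). Let $\omega_N(k),\omega_\infty(k)\ge0$ be the square roots in $h_N(k)^2=\omega_N(k)^2$ and $h_\infty(k)^2=\omega_\infty(k)^2$. The lattice vacuum $\omega^{(N)}_0$ is the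 quasi-free state with kernel $S^{(N)}_0(k)=\frac12(1-h_N(k)/\omega_N(k))$, and the continuum vacuum $\omega_\infty$ is the quasi-free state with kernel $\frac12(1-h_\infty(k)/\omega_\infty(k))$, where either kernel is read as $\frac12$ where the denominator vanishes. Then, for every $N$, $$\lim_{M\to\infty}\|\omega_0^{(N+M)}\circ\alpha^N_{N+M}-\omega_\infty\circ\alpha^N_\infty\|=0 .$$ This holds on $\mathfrak A_N$ for both mass terms and on $\mathfrak B_N$ for the Majorana mass term. -/

import Mathlib

open scoped ENNReal ComplexOrder InnerProductSpace ComplexConjugate CStarAlgebra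
open Filter Topology MeasureTheory

noncomputable section

namespace LatticeFermions

/-! ### Universal unital C*-algebras given by generators and bounded relations -/

/-- Relations on a family of elements, indexed by `X`, of a unital C*-algebra, which bound the norm
of each element of the family. -/
structure CStarRel (X : Type) where
  holds : ∀ (B : Type) [CStarAlgebra B], (X → B) → Prop
  bound : X → ℝ
  norm_le : ∀ (B : Type) [CStarAlgebra B] (g : X → B), holds B g → ∀ x, ‖g x‖ ≤ bound x

namespace CStarRel

variable {X Y : Type} (r : CStarRel X)

/-- A realization of the relations in a nonzero unital C*-algebra. -/
structure Rep : Type 1 where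
  carrier : Type
  [alg : CStarAlgebra carrier]
  [nontrivial : Nontrivial carrier]
  gen : X → carrier
  holds : r.holds carrier gen

attribute [instance] Rep.alg Rep.nontrivial

/-- The C*-algebra of bounded families of elements, one in each realization. -/
abbrev Ambient : Type 1 := lp (fun i : r.Rep => i.carrier) ∞

instance : CStarAlgebra r.Ambient where

def ambientGen (x : X) : r.Ambient :=
  ⟨fun i => i.gen x, memℓp_infty ⟨r.bound x, by
    rintro _ ⟨i, rfl⟩
    exact r.norm_le _ _ i.holds x⟩⟩

def subalg : StarSubalgebra ℂ r.Ambient :=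
  (StarAlgebra.adjoin ℂ (Set.range r.ambientGen)).topologicalClosure

instance : IsClosed (r.subalg : Set r.Ambient) :=
  StarSubalgebra.isClosed_topologicalClosure _

/-- The universal unital C*-algebra of the relations: the C*-algebra generated by the generators in
the product of all realizations. -/
def Alg : Type 1 := r.subalg

instance : CStarAlgebra r.Alg := inferInstanceAs (CStarAlgebra r.subalg)

theorem ambientGen_mem (x : X) : r.ambientGen x ∈ r.subalg :=
  StarSubalgebra.le_topologicalClosure _ (StarAlgebra.subset_adjoin ℂ _ ⟨x, rfl⟩)

def gen (x : X) : r.Alg := ⟨r.ambientGen x, r.ambientGen_mem x⟩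

/-- The universal property: the homomorphism to a realization. -/
def eval (i : r.Rep) : r.Alg →⋆ₐ[ℂ] i.carrier where
  toFun a := a.1 i
  map_one' := rfl
  map_mul' _ _ := rfl
  map_zero' := rfl
  map_add' _ _ := rfl
  commutes' _ := rfl
  map_star' _ := rfl

theorem eval_gen (i : r.Rep) (x : X) : r.eval i (r.gen x) = i.gen x := rfl

theorem ext_eval {a b : r.Alg} (h : ∀ i, r.eval i a = r.eval i b) : a = b :=
  Subtype.ext (lp.ext (funext h))

/-- The generators generate. -/
theorem adjoin_gen :
    (StarAlgebra.adjoin ℂ (Set.range r.gen)).topologicalClosure = ⊤ := by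
  let ι : r.Alg →⋆ₐ[ℂ] r.Ambient := r.subalg.subtype
  have himg : (StarAlgebra.adjoin ℂ (Set.range r.gen)).map ι
      = StarAlgebra.adjoin ℂ (Set.range r.ambientGen) := by
    rw [StarAlgHom.map_adjoin, ← Set.range_comp]
    rfl
  have hι : Topology.IsInducing ι := Topology.IsInducing.subtypeVal
  rw [eq_top_iff]
  intro a _
  have ha : ι a ∈ closure (StarAlgebra.adjoin ℂ (Set.range r.ambientGen) : Set r.Ambient) := a.2
  rw [← himg] at ha
  change a ∈ closure _
  rw [hι.closure_eq_preimage_closure_image]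
  exact ha

variable {r} {r' : CStarRel Y}

def pull (f : X → Y)
    (hf : ∀ (B : Type) [CStarAlgebra B] (g : Y → B), r'.holds B g → r.holds B (g ∘ f))
    (i : r'.Rep) : r.Rep where
  carrier := i.carrier
  gen := i.gen ∘ f
  holds := hf _ _ i.holds

def ambientMap (f : X → Y)
    (hf : ∀ (B : Type) [CStarAlgebra B] (g : Y → B), r'.holds B g → r.holds B (g ∘ f)) :
    r.Ambient →⋆ₐ[ℂ] r'.Ambient where
  toFun a := ⟨fun i => a (pull f hf i), memℓp_infty <|
    (memℓp_infty_iff.1 (lp.memℓp a)).mono <| by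
      rintro _ ⟨i, rfl⟩
      exact ⟨pull f hf i, rfl⟩⟩
  map_one' := rfl
  map_mul' _ _ := rfl
  map_zero' := rfl
  map_add' _ _ := rfl
  commutes' _ := rfl
  map_star' _ := rfl

theorem ambientMap_mem (f : X → Y)
    (hf : ∀ (B : Type) [CStarAlgebra B] (g : Y → B), r'.holds B g → r.holds B (g ∘ f))
    (a : r.subalg) : ambientMap f hf a ∈ r'.subalg := by
  have hc : Continuous (ambientMap f hf) := map_continuous _
  have h1 := StarSubalgebra.map_topologicalClosure_le
    (StarAlgebra.adjoin ℂ (Set.range r.ambientGen)) (ambientMap f hf) hc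
  have h2 : (StarAlgebra.adjoin ℂ (Set.range r.ambientGen)).map (ambientMap f hf)
      ≤ StarAlgebra.adjoin ℂ (Set.range r'.ambientGen) := by
    rw [StarAlgHom.map_adjoin, ← Set.range_comp]
    refine StarAlgebra.adjoin_mono ?_
    rintro _ ⟨x, rfl⟩
    exact ⟨f x, rfl⟩
  exact StarSubalgebra.topologicalClosure_mono h2 (h1 ⟨a, a.2, rfl⟩)

/-- The homomorphism induced by a map of generators which respects the relations. -/
def map (f : X → Y)
    (hf : ∀ (B : Type) [CStarAlgebra B] (g : Y → B), r'.holds B g → r.holds B (g ∘ f)) :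
    r.Alg →⋆ₐ[ℂ] r'.Alg :=
  ((ambientMap f hf).comp r.subalg.subtype).codRestrict r'.subalg (ambientMap_mem f hf)

theorem map_gen (f : X → Y)
    (hf : ∀ (B : Type) [CStarAlgebra B] (g : Y → B), r'.holds B g → r.holds B (g ∘ f)) (x : X) :
    map f hf (r.gen x) = r'.gen (f x) := rfl

end CStarRel

/-! ### The CAR algebra -/

section CAR

variable (h : Type) [NormedAddCommGroup h] [InnerProductSpace ℂ h]
variable {h' : Type} [NormedAddCommGroup h'] [InnerProductSpace ℂ h']

/-- The canonical anticommutation relations, for an anti-linear map `a`. -/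
structure IsCAR (B : Type*) [CStarAlgebra B] (a : h → B) : Prop where
  add : ∀ ξ η, a (ξ + η) = a ξ + a η
  smul : ∀ (c : ℂ) ξ, a (c • ξ) = conj c • a ξ
  anticomm_star : ∀ ξ η, a ξ * star (a η) + star (a η) * a ξ = algebraMap ℂ B ⟪ξ, η⟫_ℂ
  anticomm : ∀ ξ η, a ξ * a η + a η * a ξ = 0

variable {h}

theorem norm_le_of_anticomm {B : Type*} [CStarAlgebra B] (b : B) (ξ : h)
    (hb : b * star b + star b * b = algebraMap ℂ B ⟪ξ, ξ⟫_ℂ) : ‖b‖ ≤ ‖ξ‖ := by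
  let _ := CStarAlgebra.spectralOrder B
  have _ := CStarAlgebra.spectralOrderedRing B
  nontriviality B
  have h1 : star b * b ≤ algebraMap ℂ B ⟪ξ, ξ⟫_ℂ := by
    rw [← hb]
    exact le_add_of_nonneg_left (mul_star_self_nonneg b)
  have h2 := CStarAlgebra.norm_le_norm_of_nonneg_of_le (star_mul_self_nonneg b) h1
  rw [CStarRing.norm_star_mul_self, norm_algebraMap', inner_self_eq_norm_sq_to_K, norm_pow,
    RCLike.norm_ofReal, abs_norm, ← sq] at h2
  exact le_of_sq_le_sq h2 (norm_nonneg _)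

theorem IsCAR.norm_le {B : Type*} [CStarAlgebra B] {a : h → B} (ha : IsCAR h B a) (ξ : h) :
    ‖a ξ‖ ≤ ‖ξ‖ :=
  norm_le_of_anticomm _ ξ (ha.anticomm_star ξ ξ)

theorem IsCAR.comp {B : Type*} [CStarAlgebra B] {a : h' → B} (ha : IsCAR h' B a)
    (T : h →ₗᵢ[ℂ] h') : IsCAR h B (a ∘ T) where
  add ξ η := by simp [ha.add]
  smul c ξ := by simp [ha.smul]
  anticomm_star ξ η := by simpa using ha.anticomm_star (T ξ) (T η)
  anticomm ξ η := ha.anticomm _ _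

variable (h) in
def carRel : CStarRel h where
  holds B _ a := IsCAR h B a
  bound ξ := ‖ξ‖
  norm_le _ _ _ ha := ha.norm_le

variable (h) in
/-- The CAR algebra of `h`: the universal unital C*-algebra generated by `a ξ`, `ξ ∈ h`. -/
abbrev CAR : Type 1 := (carRel h).Alg

/-- The annihilation operators. -/
def CAR.a (ξ : h) : CAR h := (carRel h).gen ξ

theorem CAR.isCAR : IsCAR h (CAR h) CAR.a where
  add ξ η := CStarRel.ext_eval _ fun i => i.holds.add ξ η
  smul c ξ := CStarRel.ext_eval _ fun i => i.holds.smul c ξ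
  anticomm_star ξ η := CStarRel.ext_eval _ fun i => i.holds.anticomm_star ξ η
  anticomm ξ η := CStarRel.ext_eval _ fun i => i.holds.anticomm ξ η

/-- The homomorphism with `a ξ ↦ a (T ξ)`, for an isometry `T`. -/
def CAR.map (T : h →ₗᵢ[ℂ] h') : CAR h →⋆ₐ[ℂ] CAR h' :=
  CStarRel.map T fun _ _ _ ha => IsCAR.comp ha T

theorem CAR.map_a (T : h →ₗᵢ[ℂ] h') (ξ : h) : CAR.map T (CAR.a ξ) = CAR.a (T ξ) := rfl

end CAR

/-! ### The self-dual CAR algebra -/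

section SDC

/-- An anti-unitary involution. -/
structure Conjugation (h : Type) [NormedAddCommGroup h] [InnerProductSpace ℂ h] where
  toMap : h →ₗ⋆[ℂ] h
  involutive : ∀ ξ, toMap (toMap ξ) = ξ
  inner_map : ∀ ξ η, ⟪toMap ξ, toMap η⟫_ℂ = ⟪η, ξ⟫_ℂ

variable {h : Type} [NormedAddCommGroup h] [InnerProductSpace ℂ h]
variable {h' : Type} [NormedAddCommGroup h'] [InnerProductSpace ℂ h']

instance : CoeFun (Conjugation h) (fun _ => h → h) := ⟨fun C => C.toMap⟩

/-- The self-dual anticommutation relations, for an anti-linear map `Ψ`. -/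
structure IsSDC (C : Conjugation h) (B : Type*) [CStarAlgebra B] (Ψ : h → B) : Prop where
  add : ∀ ξ η, Ψ (ξ + η) = Ψ ξ + Ψ η
  smul : ∀ (c : ℂ) ξ, Ψ (c • ξ) = conj c • Ψ ξ
  anticomm : ∀ ξ η, Ψ ξ * Ψ η + Ψ η * Ψ ξ = algebraMap ℂ B ⟪ξ, C η⟫_ℂ
  star_eq : ∀ ξ, star (Ψ ξ) = Ψ (C ξ)

theorem IsSDC.norm_le {C : Conjugation h} {B : Type*} [CStarAlgebra B] {Ψ : h → B}
    (hΨ : IsSDC C B Ψ) (ξ : h) : ‖Ψ ξ‖ ≤ ‖ξ‖ :=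
  norm_le_of_anticomm _ ξ (by rw [hΨ.star_eq, hΨ.anticomm, C.involutive])

theorem IsSDC.comp {C : Conjugation h} {C' : Conjugation h'} {B : Type*} [CStarAlgebra B]
    {Ψ : h' → B} (hΨ : IsSDC C' B Ψ) (T : h →ₗᵢ[ℂ] h') (hT : ∀ ξ, T (C ξ) = C' (T ξ)) :
    IsSDC C B (Ψ ∘ T) where
  add ξ η := by simp [hΨ.add]
  smul c ξ := by simp [hΨ.smul]
  anticomm ξ η := by
    have := hΨ.anticomm (T ξ) (T η)
    rwa [← hT, T.inner_map_map] at this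
  star_eq ξ := by simp [hΨ.star_eq, hT]

def sdcRel (C : Conjugation h) : CStarRel h where
  holds B _ Ψ := IsSDC C B Ψ
  bound ξ := ‖ξ‖
  norm_le _ _ _ hΨ := hΨ.norm_le

/-- The self-dual CAR algebra of `(h, C)`: the universal unital C*-algebra generated by `Ψ ξ`. -/
abbrev SDC (C : Conjugation h) : Type 1 := (sdcRel C).Alg

/-- The Majorana operators. -/
def SDC.Psi (C : Conjugation h) (ξ : h) : SDC C := (sdcRel C).gen ξ

theorem SDC.isSDC (C : Conjugation h) : IsSDC C (SDC C) (SDC.Psi C) where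
  add ξ η := CStarRel.ext_eval _ fun i => i.holds.add ξ η
  smul c ξ := CStarRel.ext_eval _ fun i => i.holds.smul c ξ
  anticomm ξ η := CStarRel.ext_eval _ fun i => i.holds.anticomm ξ η
  star_eq ξ := CStarRel.ext_eval _ fun i => i.holds.star_eq ξ

/-- The homomorphism with `Ψ ξ ↦ Ψ (T ξ)`, for an isometry `T` commuting with the conjugations. -/
def SDC.map {C : Conjugation h} {C' : Conjugation h'} (T : h →ₗᵢ[ℂ] h')
    (hT : ∀ ξ, T (C ξ) = C' (T ξ)) : SDC C →⋆ₐ[ℂ] SDC C' :=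
  CStarRel.map T fun _ _ _ hΨ => IsSDC.comp hΨ T hT

theorem SDC.map_Psi {C : Conjugation h} {C' : Conjugation h'} (T : h →ₗᵢ[ℂ] h')
    (hT : ∀ ξ, T (C ξ) = C' (T ξ)) (ξ : h) :
    SDC.map T hT (SDC.Psi C ξ) = SDC.Psi C' (T ξ) := rfl

end SDC

/-! ### Quasi-free states -/

section States

/-- A state of a unital C*-algebra. -/
def IsState {A : Type*} [CStarAlgebra A] (ω : A →L[ℂ] ℂ) : Prop :=
  (∀ x, 0 ≤ ω (star x * x)) ∧ ω 1 = 1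

/-- The functional `ω ∘ α`. -/
def pullback {A B : Type*} [CStarAlgebra A] [CStarAlgebra B] (ω : B →L[ℂ] ℂ) (α : A →⋆ₐ[ℂ] B) :
    A →L[ℂ] ℂ :=
  ω.comp ⟨α.toAlgHom.toLinearMap, map_continuous α⟩

theorem pullback_apply {A B : Type*} [CStarAlgebra A] [CStarAlgebra B] (ω : B →L[ℂ] ℂ)
    (α : A →⋆ₐ[ℂ] B) (x : A) : pullback ω α x = ω (α x) := rfl

variable {h : Type} [NormedAddCommGroup h] [InnerProductSpace ℂ h]

/-- `0 ≤ S ≤ 1`. -/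
def IsUnitInterval (S : h →L[ℂ] h) : Prop := S.IsPositive ∧ (1 - S).IsPositive

/-- `ω` is the gauge-invariant quasi-free state of `S` on the CAR algebra:
`ω (a ξₙ ⋯ a ξ₁ a† η₁ ⋯ a† ηₘ) = δₙₘ det ⟪ξᵢ, (1 - S) ηⱼ⟫`. -/
structure CAR.IsQuasiFree (S : h →L[ℂ] h) (ω : CAR h →L[ℂ] ℂ) : Prop where
  isState : IsState ω
  eq_det : ∀ (n : ℕ) (ξ η : Fin n → h),
    ω ((List.ofFn fun i => CAR.a (ξ i)).reverse.prod * (List.ofFn fun j => star (CAR.a (η j))).prod)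
      = Matrix.det (Matrix.of fun i j => ⟪ξ i, η j - S (η j)⟫_ℂ)
  eq_zero : ∀ (n m : ℕ) (ξ : Fin n → h) (η : Fin m → h), n ≠ m →
    ω ((List.ofFn fun i => CAR.a (ξ i)).reverse.prod * (List.ofFn fun j => star (CAR.a (η j))).prod)
      = 0

/-- The Pfaffian of the entries above the diagonal, by expansion along the first row; it vanishes
in odd dimension. -/
def pf : (n : ℕ) → Matrix (Fin n) (Fin n) ℂ → ℂ
  | 0, _ => 1
  | 1, _ => 0
  | n + 2, A => ∑ j : Fin (n + 1), (-1) ^ (j : ℕ) * A 0 j.succ *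
      pf n (A.submatrix (fun k => (j.succAbove k).succ) (fun k => (j.succAbove k).succ))

/-- `ω` is the quasi-free state of `S` on the self-dual CAR algebra. -/
structure SDC.IsQuasiFree (C : Conjugation h) (S : h →L[ℂ] h) (ω : SDC C →L[ℂ] ℂ) : Prop where
  isState : IsState ω
  eq_pf : ∀ (n : ℕ) (ξ : Fin n → h),
    ω (List.ofFn fun i => SDC.Psi C (ξ i)).prod
      = pf n (Matrix.of fun i j => ⟪ξ i, C (ξ j) - S (C (ξ j))⟫_ℂ)

end States

/-! ### Superpositions of translates -/

section Periodize

/-- The sign `σ ^ m` as a complex number. -/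
def sgn (σ : ℤˣ) (m : ℤ) : ℂ := (((σ ^ m : ℤˣ) : ℤ) : ℂ)

theorem sgn_add (σ : ℤˣ) (m n : ℤ) : sgn σ (m + n) = sgn σ m * sgn σ n := by
  simp [sgn, zpow_add]

theorem sgn_zero (σ : ℤˣ) : sgn σ 0 = 1 := by simp [sgn]

theorem conj_sgn (σ : ℤˣ) (m : ℤ) : conj (sgn σ m) = sgn σ m := by simp [sgn]

theorem sgn_mul_self (σ : ℤˣ) (m : ℤ) : sgn σ m * sgn σ m = 1 := by
  rw [sgn, ← Int.cast_mul, ← Units.val_mul, ← sq, Int.units_sq]; simp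

theorem sgn_neg (σ : ℤˣ) (m : ℤ) : sgn σ (-m) = sgn σ m := by
  simp [sgn, zpow_neg]

variable (L : ℝ) (σ : ℤˣ)

/-- The periodic (`σ = 1`) or anti-periodic (`σ = -1`) superposition of the `2L`-translates. -/
def periodize (f : ℝ → ℂ) (y : ℝ) : ℂ := ∑' m : ℤ, sgn σ m * f (y + 2 * L * m)

variable {L}

theorem exists_bound (hL : 0 < L) {f : ℝ → ℂ} (hf : HasCompactSupport f) (r : ℝ) :
    ∃ M : ℕ, ∀ y ∈ Set.Icc (-r) r, ∀ m : ℤ, m ∉ Finset.Icc (-(M : ℤ)) M →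
      f (y + 2 * L * m) = 0 := by
  obtain ⟨R, hR⟩ := hf.isCompact.isBounded.subset_closedBall (0 : ℝ)
  obtain ⟨M, hM⟩ := exists_nat_gt ((|R| + |r|) / (2 * L))
  refine ⟨M, fun y hy m hm => ?_⟩
  by_contra hne
  have h1 : y + 2 * L * m ∈ Metric.closedBall (0 : ℝ) R := hR (subset_tsupport _ hne)
  rw [mem_closedBall_zero_iff, Real.norm_eq_abs, abs_le] at h1
  rw [div_lt_iff₀ (by positivity)] at hM
  have h2 := le_abs_self R
  have h3 := le_abs_self r
  simp only [Finset.mem_Icc, not_and_or, not_le] at hm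
  rcases hm with hm | hm
  · have : (m : ℝ) < -(M : ℝ) := by exact_mod_cast hm
    nlinarith [hy.1, hy.2, h1.1, h1.2]
  · have : (M : ℝ) < m := by exact_mod_cast hm
    nlinarith [hy.1, hy.2, h1.1, h1.2]

theorem periodize_eq_sum {f : ℝ → ℂ} {y : ℝ} {s : Finset ℤ}
    (h : ∀ m ∉ s, f (y + 2 * L * m) = 0) :
    periodize L σ f y = ∑ m ∈ s, sgn σ m * f (y + 2 * L * m) :=
  tsum_eq_sum fun m hm => by rw [h m hm, mul_zero]

theorem periodize_add (f : ℝ → ℂ) (y : ℝ) (q : ℤ) :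
    periodize L σ f (y + 2 * L * q) = sgn σ q * periodize L σ f y := by
  rw [periodize, periodize, ← tsum_mul_left, ← (Equiv.subRight q).tsum_eq]
  refine tsum_congr fun m => ?_
  simp only [Equiv.subRight_apply]
  rw [sub_eq_add_neg, sgn_add, sgn_neg, Int.cast_add, Int.cast_neg]
  rw [show y + 2 * L * q + 2 * L * (m + -(q : ℝ)) = y + 2 * L * m by ring]
  ring

theorem memLp_periodize (hL : 0 < L) (σ : ℤˣ) {f : ℝ → ℂ} (hf : MemLp f 2) (hc : HasCompactSupport f) (r : ℝ) :
    MemLp (periodize L σ f) 2 (volume.restrict (Set.Icc (-r) r)) := by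
  obtain ⟨M, hM⟩ := exists_bound hL hc r
  have h1 : MemLp (fun y => ∑ m ∈ Finset.Icc (-(M : ℤ)) M, sgn σ m * f (y + 2 * L * m)) 2
      (volume.restrict (Set.Icc (-r) r)) := by
    refine memLp_finsetSum _ fun m _ => MemLp.restrict _ ?_
    refine MemLp.const_mul ?_ _
    exact hf.comp_measurePreserving (measurePreserving_add_right volume (2 * L * m))
  refine h1.ae_eq ?_
  filter_upwards [ae_restrict_mem measurableSet_Icc] with y hy
  exact (periodize_eq_sum σ (hM y hy)).symm

theorem memLp_periodize_Ioc (hL : 0 < L) (σ : ℤˣ) {f : ℝ → ℂ} (hf : MemLp f 2) (hc : HasCompactSupport f) :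
    MemLp (periodize L σ f) 2 (volume.restrict (Set.Ioc (-L) L)) :=
  (memLp_periodize hL σ hf hc L).mono_measure
    (Measure.restrict_mono Set.Ioc_subset_Icc_self le_rfl)

/-- Unfolding of the inner product of two superpositions. -/
theorem integral_periodize (hL : 0 < L) (σ : ℤˣ) {f g : ℝ → ℂ} (hf : MemLp f 2) (hfc : HasCompactSupport f)
    (hg : MemLp g 2) (hgc : HasCompactSupport g) :
    ∫ y in Set.Ioc (-L) L, periodize L σ g y * conj (periodize L σ f y)
      = ∑' m : ℤ, sgn σ m * ∫ y, g (y + 2 * L * m) * conj (f y) := by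
  -- a ball containing the support of `f`
  obtain ⟨R, hR⟩ := hfc.isCompact.isBounded.subset_closedBall (0 : ℝ)
  have hR' : ∀ y, y ∉ Set.Icc (-R) R → f y = 0 := by
    intro y hy
    by_contra hne
    exact hy (by simpa [Real.closedBall_eq_Icc] using hR (subset_tsupport _ hne))
  have hconj : MemLp (fun y => conj (f y)) 2 := hf.star
  -- the integrand on the line
  set k : ℝ → ℂ := fun y => periodize L σ g y * conj (f y) with hk
  have hkint : Integrable k := by
    have h1 : IntegrableOn k (Set.Icc (-R) R) := by
      have := (memLp_periodize hL σ hg hgc R).integrable_mul (hconj.restrict (Set.Icc (-R) R))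
      exact this
    refine (integrableOn_iff_integrable_of_support_subset ?_).1 h1
    intro y hy
    by_contra hne
    exact hy (by simp [hk, hR' y hne])
  have hdom := isAddFundamentalDomain_Ioc (T := 2 * L) (by positivity) (-L)
  rw [show -L + 2 * L = L by ring] at hdom
  have hfold := hdom.integral_eq_tsum'' k hkint
  obtain ⟨M, hM⟩ := exists_bound hL hfc L
  have hzm : ∀ m : ℤ, (∀ y ∈ Set.Icc (-L) L, f (y + 2 * L * m) = 0) →
      ∫ y in Set.Ioc (-L) L, sgn σ m * (periodize L σ g y * conj (f (y + 2 * L * m))) = 0 := by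
    intro m hm
    refine setIntegral_eq_zero_of_forall_eq_zero fun y hy => ?_
    simp [hm y (Set.Ioc_subset_Icc_self hy)]
  have hleft : ∫ y, k y = ∫ y in Set.Ioc (-L) L, periodize L σ g y * conj (periodize L σ f y) := by
    have hpos : (0 : ℝ) < 2 * L := by positivity
    let e : ℤ ≃ AddSubgroup.zmultiples (2 * L) :=
      Equiv.ofBijective (fun n => ⟨n • (2 * L), n, rfl⟩)
        ⟨fun a b hab => by
          have := congrArg Subtype.val hab
          simpa [hpos.ne', hL.ne'] using this, by
          rintro ⟨_, n, rfl⟩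
          exact ⟨n, rfl⟩⟩
    have hterm : ∀ m : ℤ, (∫ y in Set.Ioc (-L) L, k (e m +ᵥ y))
        = ∫ y in Set.Ioc (-L) L,
            sgn σ m * (periodize L σ g y * conj (f (y + 2 * L * m))) := by
      intro m
      refine integral_congr_ae (Eventually.of_forall fun y => ?_)
      have : (e m +ᵥ y : ℝ) = y + 2 * L * m := by
        change m • (2 * L) + y = _
        rw [zsmul_eq_mul]; ring
      simp only [this, hk, periodize_add]
      ring
    rw [hfold, ← e.tsum_eq, tsum_congr hterm, tsum_eq_sum (s := Finset.Icc (-(M : ℤ)) M)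
      (fun m hm => hzm m fun y hy => hM y hy m hm), ← integral_finsetSum]
    · refine setIntegral_congr_fun measurableSet_Ioc fun y hy => ?_
      simp only [periodize_eq_sum σ (hM y (Set.Ioc_subset_Icc_self hy)), map_sum, map_mul,
        conj_sgn, Finset.mul_sum]
      exact Finset.sum_congr rfl fun m _ => by ring
    · intro m _
      refine Integrable.const_mul ?_ _
      exact (memLp_periodize_Ioc hL σ hg hgc).integrable_mul ((hconj.comp_measurePreserving
        (measurePreserving_add_right volume (2 * L * m))).restrict _)
  rw [← hleft]
  obtain ⟨M', hM'⟩ := exists_bound hL hgc R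
  have hk' : k = fun y => ∑ m ∈ Finset.Icc (-(M' : ℤ)) M',
      sgn σ m * (g (y + 2 * L * m) * conj (f y)) := by
    funext y
    by_cases hy : y ∈ Set.Icc (-R) R
    · simp only [hk]
      rw [periodize_eq_sum σ (hM' y hy), Finset.sum_mul]
      exact Finset.sum_congr rfl fun m _ => by ring
    · simp [hk, hR' y hy]
  rw [hk', integral_finsetSum]
  · rw [tsum_eq_sum (s := Finset.Icc (-(M' : ℤ)) M')]
    · simp only [integral_const_mul]
    · intro m hm
      rw [integral_eq_zero_of_ae, mul_zero]
      filter_upwards with y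
      by_cases hy : y ∈ Set.Icc (-R) R
      · simp [hM' y hy m hm]
      · simp [hR' y hy]
  · intro m _
    refine Integrable.const_mul ?_ _
    exact (hg.comp_measurePreserving
      (measurePreserving_add_right volume (2 * L * m))).integrable_mul hconj

end Periodize

/-! ### One-particle spaces -/

/-- The volume: a circle of length `2 L`, with `2 L0` sites at the coarsest scale. -/
structure Volume where
  L : ℝ
  L_pos : 0 < L
  L0 : ℕ
  L0_pos : 0 < L0

namespace Volume

variable (V : Volume)

/-- `L_N = 2 ^ N L_0`. -/
def size (N : ℕ) : ℕ := 2 ^ N * V.L0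

/-- The lattice spacing `ε_N`, with `ε_N L_N = L`; hence `ε_N = 2 ^ (-N) ε_0`. -/
def eps (N : ℕ) : ℝ := V.L / V.size N

/-- The lattice sites `x = ε_N n`, labelled by `n ∈ {-L_N, …, L_N - 1}`. -/
abbrev Site (N : ℕ) : Type := ↥(Finset.Ico (-(V.size N : ℤ)) (V.size N))

/-- The scalar one-particle space on the lattice. -/
abbrev LatticeScalar (N : ℕ) : Type := EuclideanSpace ℂ (V.Site N)

/-- The scalar one-particle space in the continuum. -/
abbrev ContScalar : Type := Lp ℂ 2 (volume.restrict (Set.Ioc (-V.L) V.L))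

theorem size_pos (N : ℕ) : 0 < V.size N := Nat.mul_pos (by positivity) V.L0_pos

theorem eps_pos (N : ℕ) : 0 < V.eps N := div_pos V.L_pos (by exact_mod_cast V.size_pos N)

theorem eps_mul_size (N : ℕ) : V.eps N * V.size N = V.L :=
  div_mul_cancel₀ _ (by exact_mod_cast (V.size_pos N).ne')

theorem eps_succ (N : ℕ) : V.eps N = 2 * V.eps (N + 1) := by
  have := V.L0_pos
  simp only [eps, size]
  push_cast
  field_simp
  ring

end Volume

/-! ### Scaling functions -/

/-- A compactly supported orthonormal scaling function with its low-pass filter. -/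
structure ScalingFunction where
  s : ℝ → ℂ
  filter : ℤ →₀ ℂ
  memLp : MemLp s 2
  hasCompactSupport : HasCompactSupport s
  integral_eq_one : ∫ x, s x = 1
  orthonormal : ∀ m n : ℤ, ∫ x, s (x - n) * conj (s (x - m)) = if m = n then 1 else 0
  scaling : ∀ᵐ x, s x = filter.sum fun n c => c * (√2 : ℝ) * s (2 * x - n)

namespace ScalingFunction

variable (φ : ScalingFunction) (V : Volume) (σ : ℤˣ)

/-- The scaling function is real-valued. -/
def IsReal : Prop := ∀ᵐ x, conj (φ.s x) = φ.s x

/-- The rescaled scaling function `ε_N ^ (-1/2) s (ε_N⁻¹ (y - ε_N z))`. -/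
def atom (N : ℕ) (z : ℤ) (y : ℝ) : ℂ :=
  ((√(V.eps N))⁻¹ : ℝ) * φ.s ((V.eps N)⁻¹ * (y - V.eps N * z))

theorem memLp_comp_affine {f : ℝ → ℂ} (hf : MemLp f 2) {a : ℝ} (ha : a ≠ 0) (b : ℝ) :
    MemLp (fun y => f (a * (y - b))) 2 := by
  have h1 : MemLp (fun y => f (a * y)) 2 := by
    have hmap : Measure.map (fun y => a * y) volume = ENNReal.ofReal |a⁻¹| • (volume : Measure ℝ) :=
      Real.map_volume_mul_left ha
    refine MemLp.comp_of_map ?_ (by fun_prop)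
    rw [hmap]
    exact hf.smul_measure ENNReal.ofReal_ne_top
  exact h1.comp_measurePreserving (measurePreserving_sub_right volume b)

theorem memLp_atom (N : ℕ) (z : ℤ) : MemLp (φ.atom V N z) 2 :=
  (memLp_comp_affine φ.memLp (inv_ne_zero (V.eps_pos N).ne') _).const_mul _

theorem hasCompactSupport_atom (N : ℕ) (z : ℤ) : HasCompactSupport (φ.atom V N z) := by
  have he : (V.eps N)⁻¹ ≠ 0 := inv_ne_zero (V.eps_pos N).ne'
  have h1 : HasCompactSupport fun y => φ.s ((V.eps N)⁻¹ * (y - V.eps N * z)) :=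
    φ.hasCompactSupport.comp_homeomorph
      ((Homeomorph.subRight (V.eps N * z)).trans (Homeomorph.mulLeft₀ _ he))
  exact h1.mul_left

theorem atom_shift (N : ℕ) (z m : ℤ) (y : ℝ) :
    φ.atom V N z (y + 2 * V.L * m) = φ.atom V N (z - 2 * V.size N * m) y := by
  simp only [atom]
  rw [← V.eps_mul_size N]
  push_cast
  congr 3
  ring

theorem integral_atom (N : ℕ) (z w : ℤ) :
    ∫ y, φ.atom V N w y * conj (φ.atom V N z y) = if z = w then 1 else 0 := by
  have he := V.eps_pos N
  rw [← φ.orthonormal z w]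
  have h1 : ∀ y, φ.atom V N w y * conj (φ.atom V N z y) = (((V.eps N)⁻¹ : ℝ) : ℂ) *
      (fun x => φ.s (x - w) * conj (φ.s (x - z))) ((V.eps N)⁻¹ * y) := by
    intro y
    have hw : ∀ w : ℤ, (V.eps N)⁻¹ * (y - V.eps N * w) = (V.eps N)⁻¹ * y - w := by
      intro w; field_simp
    have hs : (√(V.eps N))⁻¹ * (√(V.eps N))⁻¹ = (V.eps N)⁻¹ := by
      rw [← mul_inv, Real.mul_self_sqrt he.le]
    simp only [atom, hw, map_mul, Complex.conj_ofReal]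
    rw [← hs]
    push_cast
    ring
  simp_rw [h1]
  rw [integral_const_mul, Measure.integral_comp_mul_left
    (fun x => φ.s (x - w) * conj (φ.s (x - z))), inv_inv, abs_of_pos he]
  rw [Complex.real_smul, ← mul_assoc, ← Complex.ofReal_mul, inv_mul_cancel₀ he.ne',
    Complex.ofReal_one, one_mul]

theorem atom_refine (N : ℕ) (z : ℤ) : ∀ᵐ y, φ.atom V N z y
    = φ.filter.sum fun p c => c * φ.atom V (N + 1) (2 * z + p) y := by
  have he := V.eps_pos (N + 1)
  have hq : Measure.QuasiMeasurePreserving (fun y : ℝ => (V.eps N)⁻¹ * (y - V.eps N * z))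
      volume volume := by
    have h1 : Measure.QuasiMeasurePreserving (fun y : ℝ => (V.eps N)⁻¹ * y) volume volume := by
      refine ⟨by fun_prop, ?_⟩
      rw [Real.map_volume_mul_left (inv_ne_zero (V.eps_pos N).ne')]
      exact Measure.smul_absolutelyContinuous
    exact h1.comp (measurePreserving_sub_right volume _).quasiMeasurePreserving
  filter_upwards [hq.ae φ.scaling] with y hy
  rw [atom, hy, Finsupp.sum, Finsupp.sum, Finset.mul_sum]
  refine Finset.sum_congr rfl fun p _ => ?_
  have hs : (√(V.eps N))⁻¹ * √2 = (√(V.eps (N + 1)))⁻¹ := by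
    rw [V.eps_succ N, Real.sqrt_mul (by norm_num)]
    have : √(V.eps (N + 1)) ≠ 0 := (Real.sqrt_pos.2 he).ne'
    field_simp
  have ha : 2 * ((V.eps N)⁻¹ * (y - V.eps N * z)) - p
      = (V.eps (N + 1))⁻¹ * (y - V.eps (N + 1) * ((2 * z + p : ℤ) : ℝ)) := by
    rw [V.eps_succ N]
    push_cast
    field_simp
    ring
  rw [atom, ← hs, ha]
  push_cast
  ring

/-- The periodized rescaled scaling function at `ε_N z`. -/
def wave (N : ℕ) (z : ℤ) : V.ContScalar :=
  (memLp_periodize_Ioc V.L_pos σ (φ.memLp_atom V N z) (φ.hasCompactSupport_atom V N z)).toLp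
    (periodize V.L σ (φ.atom V N z))

theorem coeFn_wave (N : ℕ) (z : ℤ) :
    φ.wave V σ N z =ᵐ[volume.restrict (Set.Ioc (-V.L) V.L)] periodize V.L σ (φ.atom V N z) :=
  MemLp.coeFn_toLp _

theorem wave_shift (N : ℕ) (z q : ℤ) :
    φ.wave V σ N (z + 2 * V.size N * q) = sgn σ q • φ.wave V σ N z := by
  have : periodize V.L σ (φ.atom V N (z + 2 * V.size N * q))
      = sgn σ q • periodize V.L σ (φ.atom V N z) := by
    funext y
    have h := periodize_add (L := V.L) σ (φ.atom V N z) y (-q)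
    rw [sgn_neg] at h
    rw [Pi.smul_apply, smul_eq_mul, ← h]
    refine tsum_congr fun m => ?_
    rw [atom_shift, atom_shift, atom_shift]
    congr 2
    ring
  simp only [wave, this]
  exact MemLp.toLp_const_smul _ _

theorem inner_wave (N : ℕ) (z w : V.Site N) :
    ⟪φ.wave V σ N z, φ.wave V σ N w⟫_ℂ = if z = w then 1 else 0 := by
  have h1 : ⟪φ.wave V σ N z, φ.wave V σ N w⟫_ℂ = ∫ y in Set.Ioc (-V.L) V.L,
      periodize V.L σ (φ.atom V N w) y * conj (periodize V.L σ (φ.atom V N z) y) := by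
    rw [L2.inner_def]
    refine integral_congr_ae ?_
    filter_upwards [φ.coeFn_wave V σ N z, φ.coeFn_wave V σ N w] with y hz hw
    rw [hz, hw]
    rfl
  rw [h1, integral_periodize V.L_pos σ (φ.memLp_atom V N z) (φ.hasCompactSupport_atom V N z)
    (φ.memLp_atom V N w) (φ.hasCompactSupport_atom V N w)]
  simp_rw [atom_shift, integral_atom]
  have hz := Finset.mem_Ico.1 z.2
  have hw := Finset.mem_Ico.1 w.2
  rw [tsum_eq_single 0]
  · rw [sgn_zero, one_mul, mul_zero, sub_zero]
    exact if_congr Subtype.ext_iff.symm rfl rfl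
  · intro m hm
    rw [if_neg, mul_zero]
    intro h
    have hs : (0 : ℤ) < V.size N := by exact_mod_cast V.size_pos N
    rcases lt_or_gt_of_ne hm with hm | hm
    · nlinarith
    · nlinarith

theorem wave_refine (N : ℕ) (z : ℤ) : φ.wave V σ N z
    = φ.filter.sum fun p c => c • φ.wave V σ (N + 1) (2 * z + p) := by
  have h1 : ∀ᵐ y, ∀ m : ℤ, φ.atom V N z (y + 2 * V.L * m)
      = φ.filter.sum fun p c => c * φ.atom V (N + 1) (2 * z + p) (y + 2 * V.L * m) :=
    ae_all_iff.2 fun m => (measurePreserving_add_right volume (2 * V.L * m)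
      ).quasiMeasurePreserving.ae (φ.atom_refine V N z)
  have h2 : ∀ y ∈ Set.Ioc (-V.L) V.L, ∀ p : ℤ, Summable fun m : ℤ =>
      sgn σ m * φ.atom V (N + 1) (2 * z + p) (y + 2 * V.L * m) := by
    intro y hy p
    obtain ⟨M, hM⟩ := exists_bound V.L_pos (φ.hasCompactSupport_atom V (N + 1) (2 * z + p)) V.L
    refine summable_of_ne_finset_zero (s := Finset.Icc (-(M : ℤ)) M) fun m hm => ?_
    rw [hM y (Set.Ioc_subset_Icc_self hy) m hm, mul_zero]
  have h3 : ∀ᵐ y ∂volume.restrict (Set.Ioc (-V.L) V.L), ∀ p : ℤ,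
      φ.wave V σ (N + 1) (2 * z + p) y = periodize V.L σ (φ.atom V (N + 1) (2 * z + p)) y :=
    ae_all_iff.2 fun p => φ.coeFn_wave V σ (N + 1) (2 * z + p)
  have h4 : ∀ t : Finset ℤ, ((∑ p ∈ t, φ.filter p • φ.wave V σ (N + 1) (2 * z + p) :
      V.ContScalar) : ℝ → ℂ) =ᵐ[volume.restrict (Set.Ioc (-V.L) V.L)]
      fun y => ∑ p ∈ t, φ.filter p * φ.wave V σ (N + 1) (2 * z + p) y := by
    intro t
    induction t using Finset.induction_on with
    | empty =>
      simp only [Finset.sum_empty]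
      exact Lp.coeFn_zero _ _ _
    | insert p t hp ih =>
      simp only [Finset.sum_insert hp]
      filter_upwards [Lp.coeFn_add (φ.filter p • φ.wave V σ (N + 1) (2 * z + p))
        (∑ p ∈ t, φ.filter p • φ.wave V σ (N + 1) (2 * z + p)),
        Lp.coeFn_smul (φ.filter p) (φ.wave V σ (N + 1) (2 * z + p)), ih] with y h5 h6 h7
      rw [h5, Pi.add_apply, h6, h7]
      rfl
  refine Lp.ext ?_
  filter_upwards [φ.coeFn_wave V σ N z, h3, h4 φ.filter.support, ae_restrict_of_ae h1,
    ae_restrict_mem measurableSet_Ioc] with y h5 h6 h7 h8 hy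
  rw [h5, Finsupp.sum, h7]
  simp only [periodize, h8, Finsupp.sum, Finset.mul_sum]
  rw [Summable.tsum_finsetSum]
  · refine Finset.sum_congr rfl fun p _ => ?_
    rw [h6 p, periodize, ← tsum_mul_left]
    exact tsum_congr fun m => by ring
  · intro p _
    exact ((h2 y hy p).mul_left (φ.filter p)).congr fun m => by ring

theorem star_wave (hφ : φ.IsReal) (N : ℕ) (z : ℤ) :
    star (φ.wave V σ N z) = φ.wave V σ N z := by
  have hq : Measure.QuasiMeasurePreserving (fun y : ℝ => (V.eps N)⁻¹ * (y - V.eps N * z))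
      volume volume := by
    have h1 : Measure.QuasiMeasurePreserving (fun y : ℝ => (V.eps N)⁻¹ * y) volume volume := by
      refine ⟨by fun_prop, ?_⟩
      rw [Real.map_volume_mul_left (inv_ne_zero (V.eps_pos N).ne')]
      exact Measure.smul_absolutelyContinuous
    exact h1.comp (measurePreserving_sub_right volume _).quasiMeasurePreserving
  have h0 : ∀ᵐ y, conj (φ.atom V N z y) = φ.atom V N z y := by
    filter_upwards [hq.ae hφ] with y hy
    rw [atom, map_mul, hy, Complex.conj_ofReal]
  have h1 : ∀ᵐ y, ∀ m : ℤ, conj (φ.atom V N z (y + 2 * V.L * m))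
      = φ.atom V N z (y + 2 * V.L * m) :=
    ae_all_iff.2 fun m => (measurePreserving_add_right volume (2 * V.L * m)
      ).quasiMeasurePreserving.ae h0
  refine Lp.ext ?_
  filter_upwards [Lp.coeFn_star (φ.wave V σ N z), φ.coeFn_wave V σ N z, ae_restrict_of_ae h1]
    with y h2 h3 h4
  rw [h2, Pi.star_apply, h3, periodize, tsum_star]
  refine tsum_congr fun m => ?_
  rw [star_mul', ← starRingEnd_apply, ← starRingEnd_apply, conj_sgn, h4]


/-! ### The wavelet renormalization group: scalar one-particle maps -/

end ScalingFunction

namespace Volume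

variable (V : Volume) (σ : ℤˣ)

/-- The site congruent to `z` modulo `2 L_N`. -/
def residue (N : ℕ) (z : ℤ) : V.Site N :=
  ⟨(z + V.size N) % (2 * V.size N) - V.size N, by
    have h : (0 : ℤ) < 2 * V.size N := by have := V.size_pos N; omega
    have h1 := Int.emod_nonneg (z + V.size N) h.ne'
    have h2 := Int.emod_lt_of_pos (z + V.size N) h
    exact Finset.mem_Ico.2 ⟨by omega, by omega⟩⟩

/-- The basis vector `δ_x` at `x = ε_N z`, for every integer `z`; it is extended from the sites
periodically (`σ = 1`) or anti-periodically (`σ = -1`). -/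
def delta (N : ℕ) (z : ℤ) : V.LatticeScalar N :=
  sgn σ ((z + V.size N) / (2 * V.size N)) • EuclideanSpace.single (V.residue N z) 1

end Volume

namespace ScalingFunction

variable (φ : ScalingFunction) (V : Volume) (σ : ℤˣ)

def toContLinear (N : ℕ) : V.LatticeScalar N →ₗ[ℂ] V.ContScalar where
  toFun ξ := ∑ x : V.Site N, ξ x • φ.wave V σ N x
  map_add' ξ η := by simp [add_smul, Finset.sum_add_distrib]
  map_smul' c ξ := by simp [Finset.smul_sum, mul_smul]

/-- `R^N_∞ ξ = ∑ x, ξ_x s_x`, for a scalar field. -/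
def toCont (N : ℕ) : V.LatticeScalar N →ₗᵢ[ℂ] V.ContScalar :=
  (φ.toContLinear V σ N).isometryOfInner fun ξ η => by
    simp only [toContLinear, LinearMap.coe_mk, AddHom.coe_mk, sum_inner, inner_sum,
      inner_smul_left, inner_smul_right, inner_wave, PiLp.inner_apply, RCLike.inner_apply]
    refine Finset.sum_congr rfl fun x _ => ?_
    rw [Finset.sum_eq_single x]
    · simp [mul_comm]
    · intro y _ hy
      simp [hy]
    · simp

theorem toCont_apply (N : ℕ) (ξ : V.LatticeScalar N) :
    φ.toCont V σ N ξ = ∑ x : V.Site N, ξ x • φ.wave V σ N x := rfl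

theorem toCont_delta (N : ℕ) (z : ℤ) :
    φ.toCont V σ N (V.delta σ N z) = φ.wave V σ N z := by
  have h1 : φ.toCont V σ N (EuclideanSpace.single (V.residue N z) 1)
      = φ.wave V σ N (V.residue N z) := by
    rw [toCont_apply, Finset.sum_eq_single (V.residue N z)]
    · simp
    · intro y _ hy
      simp [hy]
    · simp
  rw [Volume.delta, map_smul, h1, ← wave_shift]
  congr 1
  have := Int.emod_add_mul_ediv (z + V.size N) (2 * V.size N)
  simp only [Volume.residue]
  linarith

def stepLinear (N : ℕ) : V.LatticeScalar N →ₗ[ℂ] V.LatticeScalar (N + 1) where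
  toFun ξ := ∑ x : V.Site N, ξ x • φ.filter.sum fun n c => c • V.delta σ (N + 1) (2 * x + n)
  map_add' ξ η := by simp [add_smul, Finset.sum_add_distrib]
  map_smul' c ξ := by simp [Finset.smul_sum, mul_smul]

theorem toCont_stepLinear (N : ℕ) (ξ : V.LatticeScalar N) :
    φ.toCont V σ (N + 1) (φ.stepLinear V σ N ξ) = φ.toCont V σ N ξ := by
  simp only [stepLinear, LinearMap.coe_mk, AddHom.coe_mk, map_sum, map_smul, Finsupp.sum,
    toCont_delta]
  rw [toCont_apply]
  refine Finset.sum_congr rfl fun x _ => ?_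
  rw [wave_refine φ V σ N x, Finsupp.sum]

/-- `R^N_{N+1} ξ = ∑ x, ξ_x ∑ n, h_n δ_{x + ε_{N+1} n}`, for a scalar field. -/
def step (N : ℕ) : V.LatticeScalar N →ₗᵢ[ℂ] V.LatticeScalar (N + 1) where
  toLinearMap := φ.stepLinear V σ N
  norm_map' ξ := by
    rw [← (φ.toCont V σ (N + 1)).norm_map, toCont_stepLinear, LinearIsometry.norm_map]

theorem toCont_step (N : ℕ) (ξ : V.LatticeScalar N) :
    φ.toCont V σ (N + 1) (φ.step V σ N ξ) = φ.toCont V σ N ξ :=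
  φ.toCont_stepLinear V σ N ξ

/-- `R^N_{N+M}` for a scalar field. -/
def steps (N : ℕ) : (M : ℕ) → V.LatticeScalar N →ₗᵢ[ℂ] V.LatticeScalar (N + M)
  | 0 => LinearIsometry.id
  | M + 1 => (φ.step V σ (N + M)).comp (steps N M)

theorem toCont_steps (N M : ℕ) (ξ : V.LatticeScalar N) :
    φ.toCont V σ (N + M) (φ.steps V σ N M ξ) = φ.toCont V σ N ξ := by
  induction M with
  | zero => rfl
  | succ M ih => exact (φ.toCont_step V σ (N + M) _).trans ih

end ScalingFunction

/-! ### Two-component fields and charge conjugation -/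

/-- The one-particle space of two-component fields. -/
abbrev Spinor (K : Type) [NormedAddCommGroup K] [InnerProductSpace ℂ K] : Type :=
  PiLp 2 fun _ : Fin 2 => K

section Spinor

variable {K K' : Type} [NormedAddCommGroup K] [InnerProductSpace ℂ K]
  [NormedAddCommGroup K'] [InnerProductSpace ℂ K']

/-- The vector with component `j` equal to `u` and the other component zero. -/
def component (u : K) (j : Fin 2) : Spinor K := WithLp.toLp 2 (Pi.single j u)

/-- A scalar map acting on both components. -/
def spinorMap (T : K →ₗᵢ[ℂ] K') : Spinor K →ₗᵢ[ℂ] Spinor K' :=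
  LinearMap.isometryOfInner
    { toFun := fun ξ => WithLp.toLp 2 fun j => T (ξ j)
      map_add' := fun ξ η => by ext j; simp
      map_smul' := fun c ξ => by ext j; simp }
    fun ξ η => by simp [PiLp.inner_apply]

theorem spinorMap_apply (T : K →ₗᵢ[ℂ] K') (ξ : Spinor K) (j : Fin 2) :
    spinorMap T ξ j = T (ξ j) := rfl

/-- The charge conjugation `C ξ = σ_z (conj ξ)`. -/
def charge (c : Conjugation K) : Conjugation (Spinor K) where
  toMap :=
    { toFun := fun ξ => WithLp.toLp 2 ![c (ξ 0), -c (ξ 1)]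
      map_add' := fun ξ η => by ext j; fin_cases j <;> simp [add_comm]
      map_smul' := fun a ξ => by ext j; fin_cases j <;> simp }
  involutive ξ := by
    ext j
    fin_cases j <;> simp [c.involutive]
  inner_map ξ η := by simp [PiLp.inner_apply, Fin.sum_univ_two, c.inner_map]

theorem spinorMap_charge {c : Conjugation K} {c' : Conjugation K'} (T : K →ₗᵢ[ℂ] K')
    (hT : ∀ u, T (c u) = c' (T u)) (ξ : Spinor K) :
    spinorMap T (charge c ξ) = charge c' (spinorMap T ξ) := by
  ext j
  fin_cases j <;> simp [spinorMap_apply, charge, hT]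

end Spinor

/-- Complex conjugation of scalar lattice fields. -/
def latticeConj (V : Volume) (N : ℕ) : Conjugation (V.LatticeScalar N) where
  toMap :=
    { toFun := fun ξ => WithLp.toLp 2 fun x => conj (ξ x)
      map_add' := fun ξ η => by ext x; simp
      map_smul' := fun c ξ => by ext x; simp }
  involutive ξ := by ext x; simp
  inner_map ξ η := by simp [PiLp.inner_apply, mul_comm]

/-- Complex conjugation of scalar continuum fields. -/
def contConj (V : Volume) : Conjugation V.ContScalar where
  toMap :=
    { toFun := fun f => star f
      map_add' := fun f g => by
        refine Lp.ext ?_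
        filter_upwards [Lp.coeFn_star (f + g), Lp.coeFn_star f, Lp.coeFn_star g, Lp.coeFn_add f g,
          Lp.coeFn_add (star f) (star g)] with y h1 h2 h3 h4 h5
        rw [h1, h5, Pi.star_apply, h4, Pi.add_apply, Pi.add_apply, h2, h3, star_add]
        rfl
      map_smul' := fun c f => by
        refine Lp.ext ?_
        filter_upwards [Lp.coeFn_star (c • f), Lp.coeFn_star f, Lp.coeFn_smul c f,
          Lp.coeFn_smul (conj c) (star f)] with y h1 h2 h3 h4
        rw [h1, h4, Pi.star_apply, h3, Pi.smul_apply, Pi.smul_apply, h2, star_smul]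
        rfl }
  involutive f := star_star f
  inner_map f g := by
    rw [L2.inner_def, L2.inner_def]
    refine integral_congr_ae ?_
    filter_upwards [Lp.coeFn_star f, Lp.coeFn_star g] with y h1 h2
    simp only [LinearMap.coe_mk, AddHom.coe_mk, h1, h2, Pi.star_apply, RCLike.inner_apply,
      RCLike.star_def, Complex.conj_conj]
    ring

/-! ### The renormalization group -/

section RG

variable (φ : ScalingFunction) (V : Volume) (σ : ℤˣ)

/-- The one-particle space at scale `N`. -/
abbrev LatticeSpace (N : ℕ) : Type := Spinor (V.LatticeScalar N)

/-- The one-particle space in the continuum. -/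
abbrev ContSpace : Type := Spinor V.ContScalar

/-- `R^N_{N+M}`. -/
def rgLattice (N M : ℕ) : LatticeSpace V N →ₗᵢ[ℂ] LatticeSpace V (N + M) :=
  spinorMap (φ.steps V σ N M)

/-- `R^N_∞`. -/
def rgCont (N : ℕ) : LatticeSpace V N →ₗᵢ[ℂ] ContSpace V := spinorMap (φ.toCont V σ N)

/-- The charge conjugation at scale `N`. -/
def latticeCharge (N : ℕ) : Conjugation (LatticeSpace V N) := charge (latticeConj V N)

/-- The charge conjugation in the continuum. -/
def contCharge : Conjugation (ContSpace V) := charge (contConj V)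

theorem toCont_conj (hφ : φ.IsReal) (N : ℕ) (ξ : V.LatticeScalar N) :
    φ.toCont V σ N (latticeConj V N ξ) = contConj V (φ.toCont V σ N ξ) := by
  have h : ∀ z : ℤ, contConj V (φ.wave V σ N z) = φ.wave V σ N z := φ.star_wave V σ hφ N
  rw [ScalingFunction.toCont_apply, ScalingFunction.toCont_apply, map_sum]
  refine Finset.sum_congr rfl fun x _ => ?_
  rw [map_smulₛₗ, h]
  rfl

theorem steps_conj (hφ : φ.IsReal) (N M : ℕ) (ξ : V.LatticeScalar N) :
    φ.steps V σ N M (latticeConj V N ξ) = latticeConj V (N + M) (φ.steps V σ N M ξ) := by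
  apply (φ.toCont V σ (N + M)).injective
  rw [φ.toCont_steps, toCont_conj φ V σ hφ, toCont_conj φ V σ hφ, φ.toCont_steps]

theorem rgLattice_charge (hφ : φ.IsReal) (N M : ℕ) (ξ : LatticeSpace V N) :
    rgLattice φ V σ N M (latticeCharge V N ξ)
      = latticeCharge V (N + M) (rgLattice φ V σ N M ξ) :=
  spinorMap_charge _ (steps_conj φ V σ hφ N M) ξ

theorem rgCont_charge (hφ : φ.IsReal) (N : ℕ) (ξ : LatticeSpace V N) :
    rgCont φ V σ N (latticeCharge V N ξ) = contCharge V (rgCont φ V σ N ξ) :=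
  spinorMap_charge _ (toCont_conj φ V σ hφ N) ξ

/-- `α^N_{N+M}` on the CAR algebras. -/
def carLattice (N M : ℕ) : CAR (LatticeSpace V N) →⋆ₐ[ℂ] CAR (LatticeSpace V (N + M)) :=
  CAR.map (rgLattice φ V σ N M)

/-- `α^N_∞` on the CAR algebras. -/
def carCont (N : ℕ) : CAR (LatticeSpace V N) →⋆ₐ[ℂ] CAR (ContSpace V) :=
  CAR.map (rgCont φ V σ N)

variable {φ}

/-- `α^N_{N+M}` on the self-dual CAR algebras. -/
def sdcLattice (hφ : φ.IsReal) (N M : ℕ) :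
    SDC (latticeCharge V N) →⋆ₐ[ℂ] SDC (latticeCharge V (N + M)) :=
  SDC.map (rgLattice φ V σ N M) (rgLattice_charge φ V σ hφ N M)

/-- `α^N_∞` on the self-dual CAR algebras. -/
def sdcCont (hφ : φ.IsReal) (N : ℕ) : SDC (latticeCharge V N) →⋆ₐ[ℂ] SDC (contCharge V) :=
  SDC.map (rgCont φ V σ N) (rgCont_charge φ V σ hφ N)

end RG

/-! ### Momentum space -/

section Momentum

variable (V : Volume) (σ : ℤˣ)

/-- The shift of the momenta, in units of `π / L`: `0` for periodic and `1 / 2` for anti-periodic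
boundary conditions. -/
def shift : ℝ := if σ = 1 then 0 else 1 / 2

/-- The momenta `Γ_N`. -/
def latticeMomenta (N : ℕ) : Set ℝ :=
  {k | ∃ n : ℤ, -(V.size N : ℤ) ≤ n ∧ n < V.size N ∧ k = Real.pi / V.L * (n + shift σ)}

/-- The momenta `Γ_∞`. -/
def contMomenta : Set ℝ := {k | ∃ n : ℤ, k = Real.pi / V.L * (n + shift σ)}

/-- The plane wave `x ↦ e^{ikx}` on the lattice. -/
def latticePlaneWave (N : ℕ) (k : ℝ) : V.LatticeScalar N :=
  WithLp.toLp 2 fun x => Complex.exp (Complex.I * k * (V.eps N * (x : ℤ)))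

theorem memLp_planeWave (k : ℝ) : MemLp (fun y : ℝ => Complex.exp (Complex.I * k * y)) 2
    (volume.restrict (Set.Ioc (-V.L) V.L)) := by
  refine MemLp.of_bound (by fun_prop) 1 (Eventually.of_forall fun y => ?_)
  rw [mul_assoc, mul_comm, ← Complex.ofReal_mul, Complex.norm_exp_ofReal_mul_I]

/-- The plane wave `x ↦ e^{ikx}` in the continuum. -/
def contPlaneWave (k : ℝ) : V.ContScalar := (memLp_planeWave V k).toLp _

/-- `S` is diagonal in momentum space with kernel `s`:
`⟪e_{k,i}, S e_{l,j}⟫ = 2 L_N δ_{kl} s(k)_{ij}`. -/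
def LatticeKernel (N : ℕ) (S : LatticeSpace V N →L[ℂ] LatticeSpace V N)
    (s : ℝ → Matrix (Fin 2) (Fin 2) ℂ) : Prop :=
  ∀ k ∈ latticeMomenta V σ N, ∀ l ∈ latticeMomenta V σ N, ∀ i j : Fin 2,
    ⟪component (latticePlaneWave V N k) i, S (component (latticePlaneWave V N l) j)⟫_ℂ
      = open Classical in if k = l then 2 * V.size N * s k i j else 0

/-- `S` is diagonal in momentum space with kernel `s`:
`⟪e_{k,i}, S e_{l,j}⟫ = 2 L δ_{kl} s(k)_{ij}`. -/
def ContKernel (S : ContSpace V →L[ℂ] ContSpace V) (s : ℝ → Matrix (Fin 2) (Fin 2) ℂ) : Prop :=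
  ∀ k ∈ contMomenta V σ, ∀ l ∈ contMomenta V σ, ∀ i j : Fin 2,
    ⟪component (contPlaneWave V k) i, S (component (contPlaneWave V l) j)⟫_ℂ
      = open Classical in if k = l then 2 * V.L * s k i j else 0

end Momentum

/-! ### Dirac vacua -/

section Vacua

/-- The one-particle lattice Dirac Hamiltonian, in momentum space. -/
def diracSymbol (ε lam k : ℝ) : Matrix (Fin 2) (Fin 2) ℂ :=
  !![(lam : ℂ), Complex.exp (-(Complex.I * k * ε)) - 1;
    Complex.exp (Complex.I * k * ε) - 1, -(lam : ℂ)]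

def diracDispersion (ε lam k : ℝ) : ℝ := √(lam ^ 2 + 4 * Real.sin (ε * k / 2) ^ 2)

/-- The one-particle lattice Hamiltonian with the Majorana mass term, in momentum space. -/
def majoranaSymbol (ε lam k : ℝ) : Matrix (Fin 2) (Fin 2) ℂ :=
  !![0, lam + (Complex.exp (-(Complex.I * k * ε)) - 1);
    lam + (Complex.exp (Complex.I * k * ε) - 1), 0]

def majoranaDispersion (ε lam k : ℝ) : ℝ :=
  √(lam ^ 2 + 4 * (1 - lam) * Real.sin (ε * k / 2) ^ 2)

/-- The continuum Dirac Hamiltonian `k σ_y + m σ_z`, in momentum space. -/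
def diracSymbolCont (m k : ℝ) : Matrix (Fin 2) (Fin 2) ℂ :=
  !![(m : ℂ), -(Complex.I * k); Complex.I * k, -(m : ℂ)]

/-- The continuum Hamiltonian `k σ_y + m σ_x` with the Majorana mass term, in momentum space. -/
def majoranaSymbolCont (m k : ℝ) : Matrix (Fin 2) (Fin 2) ℂ :=
  !![0, m - Complex.I * k; m + Complex.I * k, 0]

def contDispersion (m k : ℝ) : ℝ := √(m ^ 2 + k ^ 2)

/-- The projection `(1 - H / ω) / 2` on the negative energies `-ω`; it is `1 / 2` for `ω = 0`. -/
def negativeEnergy (H : Matrix (Fin 2) (Fin 2) ℂ) (ω : ℝ) : Matrix (Fin 2) (Fin 2) ℂ :=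
  (1 / 2 : ℂ) • (1 - ((ω⁻¹ : ℝ) : ℂ) • H)

variable (V : Volume) (σ : ℤˣ)

/-- The quasi-free state on the lattice CAR algebra with the momentum-space kernel `s`. -/
def IsLatticeCARState (N : ℕ) (s : ℝ → Matrix (Fin 2) (Fin 2) ℂ)
    (ω : CAR (LatticeSpace V N) →L[ℂ] ℂ) : Prop :=
  ∃ S, IsUnitInterval S ∧ LatticeKernel V σ N S s ∧ CAR.IsQuasiFree S ω

/-- The quasi-free state on the continuum CAR algebra with the momentum-space kernel `s`. -/
def IsContCARState (s : ℝ → Matrix (Fin 2) (Fin 2) ℂ) (ω : CAR (ContSpace V) →L[ℂ] ℂ) : Prop :=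
  ∃ S, IsUnitInterval S ∧ ContKernel V σ S s ∧ CAR.IsQuasiFree S ω

/-- `C S = (1 - S) C`. -/
def IsSelfDual {h : Type} [NormedAddCommGroup h] [InnerProductSpace ℂ h] (C : Conjugation h)
    (S : h →L[ℂ] h) : Prop := ∀ ξ, C (S ξ) = C ξ - S (C ξ)

/-- The quasi-free state on the lattice self-dual CAR algebra with the momentum-space kernel `s`. -/
def IsLatticeSDCState (N : ℕ) (s : ℝ → Matrix (Fin 2) (Fin 2) ℂ)
    (ω : SDC (latticeCharge V N) →L[ℂ] ℂ) : Prop :=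
  ∃ S, IsUnitInterval S ∧ IsSelfDual (latticeCharge V N) S ∧ LatticeKernel V σ N S s ∧
    SDC.IsQuasiFree (latticeCharge V N) S ω

/-- The quasi-free state on the continuum self-dual CAR algebra with the momentum-space kernel
`s`. -/
def IsContSDCState (s : ℝ → Matrix (Fin 2) (Fin 2) ℂ) (ω : SDC (contCharge V) →L[ℂ] ℂ) : Prop :=
  ∃ S, IsUnitInterval S ∧ IsSelfDual (contCharge V) S ∧ ContKernel V σ S s ∧
    SDC.IsQuasiFree (contCharge V) S ω

end Vacua

end LatticeFermions

end

open LatticeFermions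

noncomputable section

namespace LatticeFermions

/-! The lattice algebra at a fixed scale `N` is finite-dimensional: it is spanned by ordered
products of finitely many generators whose anticommutators are scalars
(`CStarRel.finiteDimensional_of_anticomm`). On such an algebra norm convergence of functionals is
convergence on a spanning set (`tendsto_norm_sub_of_span`). Normally ordered monomials, respectively
all monomials in the self-dual case, span, and on them a quasi-free state is a determinant or a
Pfaffian, that is, a polynomial in its two-point functions. Everything reduces to the limit of ⟨R ξ,
S^{(N+M)} R η⟩ with R = R^N_{N+M}.

For this, all scales are compared inside the continuum space. Put T_N = R^N_∞ S^{(N)} (R^N_∞)^*.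
Since R^{N+M}_∞ R^N_{N+M} = R^N_∞ and the maps are isometries, the two-point function at scale `N +
M` is the matrix element of T_{N+M} between the fixed vectors R^N_∞ ξ and R^N_∞ η, so weak
convergence T_N → S is enough. The T_N are contractions, so weak convergence may be tested on the
total set of plane waves. The adjoint (R^N_∞)^* maps e_k to √ε_N conj(ŝ(ε_N k)) times the lattice
plane wave of the same momentum (`rgContAdjoint_planeWave`). Hence, for large `N`, the matrix
element of T_N between e_{k,i} and e_{l,j} is ŝ(ε_N k) conj(ŝ(ε_N l)) 2L δ_{kl} S^{(N)}(k)_{ij},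
where ε_N L_N = L was used, and ŝ(ε_N k) → ŝ(0) = ∫ s = 1. The uniform bound replaces any estimate
on the decay of ŝ.

For the vacua the kernel depends on the Hamiltonian and the dispersion only through their quotient,
so both may be divided by ε_N; the rescaled quantities converge to their continuum counterparts. The
quotient is singular only if m = 0 and k = 0, which forces periodic boundary conditions; there λ_N =
0 eventually and both kernels equal 1/2. -/

/-! ### Algebras generated by finitely many anticommuting elements -/

section Clifford

variable {A : Type*} [Ring A] [Algebra ℂ A]

/-- The span of the ordered products of sublists of `l`. -/
def monomialSpan : List A → Submodule ℂ A
  | [] => Submodule.span ℂ {1}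
  | x :: l => monomialSpan l ⊔ (monomialSpan l).map (LinearMap.mulLeft ℂ x)

instance finiteDimensional_monomialSpan (l : List A) : FiniteDimensional ℂ (monomialSpan l) := by
  induction l with
  | nil => exact inferInstanceAs (FiniteDimensional ℂ (Submodule.span ℂ {(1 : A)}))
  | cons x l ih =>
    exact inferInstanceAs (FiniteDimensional ℂ
      (monomialSpan l ⊔ (monomialSpan l).map (LinearMap.mulLeft ℂ x) : Submodule ℂ A))

theorem one_mem_monomialSpan (l : List A) : 1 ∈ monomialSpan l := by
  induction l with
  | nil => exact Submodule.mem_span_singleton_self 1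
  | cons x l ih => exact Submodule.mem_sup_left ih

/-- A letter equal to the head is absorbed because its square is a scalar; any other letter is
carried past the head at the price of a scalar anticommutator and enters the span of the shorter
list by induction. So the finite-dimensional span is stable under left multiplication by the
letters. -/
theorem mul_mem_monomialSpan {l : List A}
    (hl : ∀ x ∈ l, ∀ y ∈ l, ∃ c : ℂ, x * y + y * x = algebraMap ℂ A c) :
    ∀ x ∈ l, ∀ w ∈ monomialSpan l, x * w ∈ monomialSpan l := by
  induction l with
  | nil => simp
  | cons y l ih =>
    have ih' := ih fun x hx z hz => hl x (List.mem_cons_of_mem _ hx) z (List.mem_cons_of_mem _ hz)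
    have hy : ∀ w ∈ monomialSpan l, y * w ∈ monomialSpan (y :: l) := fun w hw =>
      Submodule.mem_sup_right ⟨w, hw, rfl⟩
    intro x hx w hw
    obtain ⟨w₁, hw₁, _, ⟨w₂, hw₂, rfl⟩, rfl⟩ := Submodule.mem_sup.1 hw
    rw [mul_add, LinearMap.mulLeft_apply, ← mul_assoc]
    rcases List.mem_cons.1 hx with rfl | hx'
    -- The relation of `x` with itself reads 2x² = c.
    · obtain ⟨c, hc⟩ := hl x hx x hx
      have hsq : x * x = algebraMap ℂ A (c / 2) := by
        have h1 : (2 : ℂ) • (x * x) = (2 : ℂ) • algebraMap ℂ A (c / 2) := by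
          rw [two_smul, hc, Algebra.algebraMap_eq_smul_one, Algebra.algebraMap_eq_smul_one, smul_smul]
          congr 1
          ring
        exact smul_right_injective A (two_ne_zero' ℂ) h1
      rw [hsq, ← Algebra.smul_def]
      exact add_mem (hy _ hw₁) (Submodule.mem_sup_left (Submodule.smul_mem _ _ hw₂))
    · obtain ⟨c, hc⟩ := hl x hx y List.mem_cons_self
      rw [eq_sub_of_add_eq hc, sub_mul, ← Algebra.smul_def, mul_assoc]
      exact add_mem (Submodule.mem_sup_left (ih' x hx' _ hw₁))
        (sub_mem (Submodule.mem_sup_left (Submodule.smul_mem _ _ hw₂)) (hy _ (ih' x hx' _ hw₂)))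

end Clifford

/-! ### Left ideals and finite dimension of the universal algebras. -/

namespace CStarRel

variable {X : Type} (r : CStarRel X)

/-- A finite-dimensional left ideal containing `1` is everything; it suffices to test with the
generators. -/
theorem eq_top_of_mul_mem (W : Submodule ℂ r.Alg) [FiniteDimensional ℂ W] (h1 : 1 ∈ W)
    (hgen : ∀ x, ∀ w ∈ W, r.gen x * w ∈ W) (hstar : ∀ x, ∀ w ∈ W, star (r.gen x) * w ∈ W) :
    W = ⊤ := by
  have hle : ∀ a ∈ StarAlgebra.adjoin ℂ (Set.range r.gen), ∀ w ∈ W, a * w ∈ W := by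
    intro a ha
    -- Adjoining as a star-subalgebra is adjoining the generators and their adjoints as an algebra,
    -- so products and sums suffice in the induction.
    rw [← StarSubalgebra.mem_toSubalgebra, StarAlgebra.adjoin_toSubalgebra] at ha
    induction ha using Algebra.adjoin_induction with
    | mem x hx =>
      rcases hx with ⟨y, rfl⟩ | hx
      · exact hgen y
      · obtain ⟨y, hy⟩ := hx
        rw [← star_star x, ← hy]
        exact hstar y
    | algebraMap c =>
      intro w hw
      rw [← Algebra.smul_def]
      exact W.smul_mem c hw
    | add x y _ _ hx hy =>
      intro w hw
      rw [add_mul]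
      exact add_mem (hx w hw) (hy w hw)
    | mul x y _ _ hx hy =>
      intro w hw
      rw [mul_assoc]
      exact hx _ (hy w hw)
  -- Finite dimension makes `W` closed, and b = b * 1 shows that it contains the dense subalgebra.
  have hclosed : IsClosed (W : Set r.Alg) := W.closed_of_finiteDimensional
  rw [eq_top_iff]
  intro a _
  have ha : a ∈ closure (StarAlgebra.adjoin ℂ (Set.range r.gen) : Set r.Alg) := by
    have h : a ∈ (StarAlgebra.adjoin ℂ (Set.range r.gen)).topologicalClosure :=
      r.adjoin_gen ▸ StarSubalgebra.mem_top
    exact h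
  refine closure_minimal (fun b hb => ?_) hclosed ha
  simpa using hle b hb 1 h1

/-- The universal algebra is finite-dimensional if its generators and their adjoints lie in the span
of finitely many elements whose anticommutators are scalars. -/
theorem finiteDimensional_of_anticomm (l : List r.Alg)
    (hl : ∀ x ∈ l, ∀ y ∈ l, ∃ c : ℂ, x * y + y * x = algebraMap ℂ r.Alg c)
    (hgen : ∀ x, r.gen x ∈ Submodule.span ℂ {y | y ∈ l})
    (hstar : ∀ x, star (r.gen x) ∈ Submodule.span ℂ {y | y ∈ l}) :
    FiniteDimensional ℂ r.Alg := by
  have key : ∀ a ∈ Submodule.span ℂ {y | y ∈ l}, ∀ w ∈ monomialSpan l, a * w ∈ monomialSpan l := by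
    intro a ha w hw
    induction ha using Submodule.span_induction with
    | mem x hx => exact mul_mem_monomialSpan hl x hx w hw
    | zero => simp
    | add x y _ _ hx hy => rw [add_mul]; exact add_mem hx hy
    | smul c x _ hx => rw [smul_mul_assoc]; exact Submodule.smul_mem _ c hx
  have htop := r.eq_top_of_mul_mem (monomialSpan l) (one_mem_monomialSpan l)
    (fun x => key _ (hgen x)) (fun x => key _ (hstar x))
  have hfin := finiteDimensional_monomialSpan l
  rw [htop] at hfin
  exact Module.finite_def.2 (Submodule.fg_top _ |>.1 (Module.finite_def.1 hfin))

end CStarRel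

/-! ### Finite dimension and spanning monomials of the fermionic algebras. -/

section FiniteDimensional

variable {h : Type} [NormedAddCommGroup h] [InnerProductSpace ℂ h] [FiniteDimensional ℂ h]

/-- An anti-linear map takes values in the span of the images of a basis. -/
theorem mem_span_of_antilinear {B : Type*} [AddCommGroup B] [Module ℂ B] {f : h → B}
    (hadd : ∀ ξ η, f (ξ + η) = f ξ + f η) (hsmul : ∀ (c : ℂ) ξ, f (c • ξ) = conj c • f ξ)
    {s : Set B} (hs : ∀ i, f (stdOrthonormalBasis ℂ h i) ∈ s) (ξ : h) :
    f ξ ∈ Submodule.span ℂ s := by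
  let f' : h →ₗ⋆[ℂ] B := { toFun := f, map_add' := hadd, map_smul' := hsmul }
  change f' ξ ∈ _
  rw [← (stdOrthonormalBasis ℂ h).sum_repr ξ, map_sum]
  refine Submodule.sum_mem _ fun i _ => ?_
  rw [map_smulₛₗ]
  exact Submodule.smul_mem _ _ (Submodule.subset_span (hs i))

/-- The letters are the annihilators of an orthonormal basis together with their adjoints; both
families are needed because the adjoint of an annihilator is not an annihilator. -/
instance CAR.finiteDimensional : FiniteDimensional ℂ (CAR h) := by
  let b := stdOrthonormalBasis ℂ h
  refine (carRel h).finiteDimensional_of_anticomm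
    (List.ofFn (fun i => CAR.a (b i)) ++ List.ofFn fun i => star (CAR.a (b i))) ?_ ?_ ?_
  · simp only [List.mem_append, List.mem_ofFn]
    rintro _ (⟨i, rfl⟩ | ⟨i, rfl⟩) _ (⟨j, rfl⟩ | ⟨j, rfl⟩)
    · exact ⟨0, by rw [CAR.isCAR.anticomm, map_zero]⟩
    · exact ⟨_, CAR.isCAR.anticomm_star _ _⟩
    · exact ⟨_, (add_comm _ _).trans (CAR.isCAR.anticomm_star _ _)⟩
    · refine ⟨0, ?_⟩
      rw [← star_mul, ← star_mul, ← star_add, CAR.isCAR.anticomm, star_zero, map_zero]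
  · exact mem_span_of_antilinear CAR.isCAR.add CAR.isCAR.smul fun i => by simp [b]
  · intro ξ
    have h1 := mem_span_of_antilinear (s := {y | y ∈ List.ofFn fun i => CAR.a (b i)})
      CAR.isCAR.add CAR.isCAR.smul (fun i => by simp [b]) ξ
    change star (CAR.a ξ) ∈ _
    generalize CAR.a ξ = x₀ at h1
    induction h1 using Submodule.span_induction with
    | mem x hx =>
      obtain ⟨i, rfl⟩ := List.mem_ofFn.1 hx
      exact Submodule.subset_span (by simp)
    | zero => simp
    | add x y _ _ hx hy => rw [star_add]; exact add_mem hx hy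
    | smul c x _ hx => rw [star_smul]; exact Submodule.smul_mem _ _ hx

/-- One family of letters suffices here, since the adjoint of a generator is again a generator. -/
instance SDC.finiteDimensional (C : Conjugation h) : FiniteDimensional ℂ (SDC C) := by
  let b := stdOrthonormalBasis ℂ h
  have hmem : ∀ ξ, SDC.Psi C ξ ∈ Submodule.span ℂ {y | y ∈ List.ofFn fun i => SDC.Psi C (b i)} :=
    mem_span_of_antilinear (SDC.isSDC C).add (SDC.isSDC C).smul fun i => by simp [b]
  refine (sdcRel C).finiteDimensional_of_anticomm _ ?_ hmem fun ξ => ?_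
  · simp only [List.mem_ofFn]
    rintro _ ⟨i, rfl⟩ _ ⟨j, rfl⟩
    exact ⟨_, (SDC.isSDC C).anticomm _ _⟩
  · change star (SDC.Psi C ξ) ∈ _
    rw [(SDC.isSDC C).star_eq]
    exact hmem _

/-- The order, annihilators to the left of creators, is the one in which quasi-free states are
prescribed. A creator multiplied from the left is pushed through the annihilators by the
anticommutation relation, each exchange leaving a scalar multiple of a shorter ordered monomial. -/
theorem CAR.span_normalOrdered : Submodule.span ℂ {x : CAR h | ∃ l l' : List h,
    x = (l.map CAR.a).prod * (l'.map fun η => star (CAR.a η)).prod} = ⊤ := by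
  set s := {x : CAR h | ∃ l l' : List h,
    x = (l.map CAR.a).prod * (l'.map fun η => star (CAR.a η)).prod}
  have hgen : ∀ ξ, ∀ w ∈ Submodule.span ℂ s, CAR.a ξ * w ∈ Submodule.span ℂ s := by
    intro ξ w hw
    induction hw using Submodule.span_induction with
    | mem x hx =>
      obtain ⟨l, l', rfl⟩ := hx
      exact Submodule.subset_span ⟨ξ :: l, l', by simp [mul_assoc]⟩
    | zero => simp
    | add x y _ _ hx hy => rw [mul_add]; exact add_mem hx hy
    | smul c x _ hx => rw [mul_smul_comm]; exact Submodule.smul_mem _ _ hx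
  have hstar : ∀ ζ, ∀ w ∈ Submodule.span ℂ s, star (CAR.a ζ) * w ∈ Submodule.span ℂ s := by
    intro ζ w hw
    induction hw using Submodule.span_induction with
    | mem x hx =>
      obtain ⟨l, l', rfl⟩ := hx
      induction l with
      | nil => exact Submodule.subset_span ⟨[], ζ :: l', by simp⟩
      | cons ξ l ih =>
        rw [List.map_cons, List.prod_cons, mul_assoc, ← mul_assoc (star _),
          eq_sub_of_add_eq' (CAR.isCAR.anticomm_star ξ ζ), sub_mul, ← Algebra.smul_def, mul_assoc]
        exact sub_mem (Submodule.smul_mem _ _ (Submodule.subset_span ⟨l, l', rfl⟩)) (hgen ξ _ ih)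
    | zero => simp
    | add x y _ _ hx hy => rw [mul_add]; exact add_mem hx hy
    | smul c x _ hx => rw [mul_smul_comm]; exact Submodule.smul_mem _ _ hx
  have hone : (1 : CAR h) ∈ Submodule.span ℂ s := Submodule.subset_span ⟨[], [], by simp⟩
  exact (carRel h).eq_top_of_mul_mem (Submodule.span ℂ s) hone hgen hstar

/-- No ordering is required, because the Pfaffian formula gives the value of a quasi-free state on
every product of generators. -/
theorem SDC.span_monomials (C : Conjugation h) :
    Submodule.span ℂ {x : SDC C | ∃ l : List h, x = (l.map (SDC.Psi C)).prod} = ⊤ := by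
  set s := {x : SDC C | ∃ l : List h, x = (l.map (SDC.Psi C)).prod}
  have hgen : ∀ ξ, ∀ w ∈ Submodule.span ℂ s, SDC.Psi C ξ * w ∈ Submodule.span ℂ s := by
    intro ξ w hw
    induction hw using Submodule.span_induction with
    | mem x hx =>
      obtain ⟨l, rfl⟩ := hx
      exact Submodule.subset_span ⟨ξ :: l, by simp⟩
    | zero => simp
    | add x y _ _ hx hy => rw [mul_add]; exact add_mem hx hy
    | smul c x _ hx => rw [mul_smul_comm]; exact Submodule.smul_mem _ _ hx
  have hone : (1 : SDC C) ∈ Submodule.span ℂ s := Submodule.subset_span ⟨[], by simp⟩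
  refine (sdcRel C).eq_top_of_mul_mem (Submodule.span ℂ s) hone hgen fun ξ w hw => ?_
  change star (SDC.Psi C ξ) * w ∈ _
  rw [(SDC.isSDC C).star_eq]
  exact hgen _ w hw

end FiniteDimensional

/-! ### Convergence of functionals -/

/-- In finite dimensions, functionals which converge on a spanning set converge in norm. -/
theorem tendsto_norm_sub_of_span {E : Type*} [NormedAddCommGroup E] [NormedSpace ℂ E]
    [FiniteDimensional ℂ E] {f : ℕ → E →L[ℂ] ℂ} {g : E →L[ℂ] ℂ} {s : Set E}
    (hs : Submodule.span ℂ s = ⊤) (h : ∀ x ∈ s, Tendsto (fun M => f M x) atTop (𝓝 (g x))) :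
    Tendsto (fun M => ‖f M - g‖) atTop (𝓝 0) := by
  have hall : ∀ x, Tendsto (fun M => f M x) atTop (𝓝 (g x)) := by
    intro x
    have hx : x ∈ Submodule.span ℂ s := hs ▸ Submodule.mem_top
    induction hx using Submodule.span_induction with
    | mem x hx => exact h x hx
    | zero => simp
    | add x y _ _ hx hy => simpa using hx.add hy
    | smul c x _ hx => simpa using hx.const_mul c
  let b := Module.finBasis ℂ E
  -- `C` depends on the basis only, so it bounds all differences `f M - g` at once by their values
  -- on the basis.
  obtain ⟨C, hC, hb⟩ := b.exists_opNorm_le (F := ℂ)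
  have hsum : Tendsto (fun M => C * ∑ i, ‖(f M - g) (b i)‖) atTop (𝓝 0) := by
    rw [show (0 : ℝ) = C * ∑ i : Fin (Module.finrank ℂ E), 0 by simp]
    refine (tendsto_finsetSum _ fun i _ => ?_).const_mul C
    exact tendsto_iff_norm_sub_tendsto_zero.1 (hall (b i))
  refine squeeze_zero (fun M => norm_nonneg _) (fun M => ?_) hsum
  exact hb (Finset.sum_nonneg fun i _ => norm_nonneg _) fun i =>
    Finset.single_le_sum (f := fun i => ‖(f M - g) (b i)‖) (fun i _ => norm_nonneg _)
      (Finset.mem_univ i)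

/-- The Pfaffian is a polynomial in the entries; the induction follows its recursion in steps of
two. -/
theorem tendsto_pf {n : ℕ} {A : ℕ → Matrix (Fin n) (Fin n) ℂ} {B : Matrix (Fin n) (Fin n) ℂ}
    (h : ∀ i j, Tendsto (fun M => A M i j) atTop (𝓝 (B i j))) :
    Tendsto (fun M => pf n (A M)) atTop (𝓝 (pf n B)) := by
  induction n using Nat.twoStepInduction with
  | zero => exact tendsto_const_nhds
  | one => exact tendsto_const_nhds
  | more n ih _ =>
    simp only [pf]
    exact tendsto_finsetSum _ fun j _ => ((h 0 j.succ).const_mul _).mul (ih fun k l => h _ _)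

/-! ### Quasi-free states restricted to finitely many modes. -/

section QuasiFree

variable {h h' : Type} [NormedAddCommGroup h] [InnerProductSpace ℂ h] [FiniteDimensional ℂ h]
  [NormedAddCommGroup h'] [InnerProductSpace ℂ h']
  {H : ℕ → Type} [∀ M, NormedAddCommGroup (H M)] [∀ M, InnerProductSpace ℂ (H M)]

/-- Quasi-free states on CAR algebras, restricted to a finite-dimensional one-particle space,
converge in norm if their two-point functions converge. -/
theorem CAR.tendsto_norm_pullback {T : ∀ M, h →ₗᵢ[ℂ] H M} {T' : h →ₗᵢ[ℂ] h'}
    {S : ∀ M, H M →L[ℂ] H M} {S' : h' →L[ℂ] h'} {ω : ∀ M, CAR (H M) →L[ℂ] ℂ} {ω' : CAR h' →L[ℂ] ℂ}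
    (hω : ∀ M, CAR.IsQuasiFree (S M) (ω M)) (hω' : CAR.IsQuasiFree S' ω')
    (hconv : ∀ ξ η, Tendsto (fun M => ⟪T M ξ, S M (T M η)⟫_ℂ) atTop (𝓝 ⟪T' ξ, S' (T' η)⟫_ℂ)) :
    Tendsto (fun M => ‖pullback (ω M) (CAR.map (T M)) - pullback ω' (CAR.map T')‖)
      atTop (𝓝 0) := by
  refine tendsto_norm_sub_of_span CAR.span_normalOrdered ?_
  rintro _ ⟨l, l', rfl⟩
  -- The determinant formula lists the annihilators with decreasing index, hence the vectors are
  -- taken from `l.reverse`.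
  have key : ∀ {K : Type} [NormedAddCommGroup K] [InnerProductSpace ℂ K] (ω : CAR K →L[ℂ] ℂ)
      (T : h →ₗᵢ[ℂ] K), pullback ω (CAR.map T)
        ((l.map CAR.a).prod * (l'.map fun η => star (CAR.a η)).prod)
      = ω ((List.ofFn fun i => CAR.a (T (l.reverse.get i))).reverse.prod
          * (List.ofFn fun j => star (CAR.a (T (l'.get j)))).prod) := by
    intro K _ _ ω T
    have h1 : (List.ofFn fun i => CAR.a (T (l.reverse.get i)))
        = l.reverse.map fun ξ => CAR.a (T ξ) := by
      conv_rhs => rw [← List.ofFn_get l.reverse, List.map_ofFn]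
      rfl
    have h2 : (List.ofFn fun j => star (CAR.a (T (l'.get j))))
        = l'.map fun ξ => star (CAR.a (T ξ)) := by
      conv_rhs => rw [← List.ofFn_get l', List.map_ofFn]
      rfl
    rw [h1, h2, pullback_apply, map_mul, map_list_prod, map_list_prod, List.map_map, List.map_map,
      ← List.map_reverse, List.reverse_reverse]
    simp only [Function.comp_def, map_star]
    rfl
  simp only [key]
  by_cases hn : l.reverse.length = l'.length
  -- The two lengths agree only propositionally, so the second family is reindexed along `hn` to
  -- make the matrix square.
  · have cast_eq : ∀ {K : Type} [NormedAddCommGroup K] [InnerProductSpace ℂ K] {S : K →L[ℂ] K}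
        {ω : CAR K →L[ℂ] ℂ} (_ : CAR.IsQuasiFree S ω) (ξ : Fin l.reverse.length → K)
        (η : Fin l'.length → K),
        ω ((List.ofFn fun i => CAR.a (ξ i)).reverse.prod *
          (List.ofFn fun j => star (CAR.a (η j))).prod)
        = Matrix.det (Matrix.of fun i j => ⟪ξ i, η (Fin.cast hn j) - S (η (Fin.cast hn j))⟫_ℂ) := by
      generalize l'.length = n' at hn
      subst hn
      intro K _ _ S ω hω ξ η
      exact hω.eq_det _ ξ η
    rw [cast_eq hω']
    refine Tendsto.congr (fun M => (cast_eq (hω M) _ _).symm) ?_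
    have hdet : Continuous fun A : Matrix (Fin l.reverse.length) (Fin l.reverse.length) ℂ => A.det :=
      continuous_id.matrix_det
    refine (hdet.tendsto _).comp (tendsto_pi_nhds.2 fun i => tendsto_pi_nhds.2 fun j => ?_)
    -- By isometry the contribution of the identity in 1 - S does not depend on `M`; only the term
    -- with S varies.
    simp only [Matrix.of_apply, inner_sub_right, LinearIsometry.inner_map_map]
    exact tendsto_const_nhds.sub (hconv _ _)
  · rw [hω'.eq_zero _ _ _ _ hn]
    exact tendsto_const_nhds.congr fun M => ((hω M).eq_zero _ _ _ _ hn).symm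

/-- Quasi-free states on self-dual CAR algebras, restricted to a finite-dimensional one-particle
space, converge in norm if their two-point functions converge. -/
theorem SDC.tendsto_norm_pullback {C : Conjugation h} {D : ∀ M, Conjugation (H M)}
    {C' : Conjugation h'} {T : ∀ M, h →ₗᵢ[ℂ] H M} {T' : h →ₗᵢ[ℂ] h'}
    (hT : ∀ M ξ, T M (C ξ) = D M (T M ξ)) (hT' : ∀ ξ, T' (C ξ) = C' (T' ξ))
    {S : ∀ M, H M →L[ℂ] H M} {S' : h' →L[ℂ] h'}
    {ω : ∀ M, SDC (D M) →L[ℂ] ℂ} {ω' : SDC C' →L[ℂ] ℂ}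
    (hω : ∀ M, SDC.IsQuasiFree (D M) (S M) (ω M)) (hω' : SDC.IsQuasiFree C' S' ω')
    (hconv : ∀ ξ η, Tendsto (fun M => ⟪T M ξ, S M (T M η)⟫_ℂ) atTop (𝓝 ⟪T' ξ, S' (T' η)⟫_ℂ)) :
    Tendsto (fun M => ‖pullback (ω M) (SDC.map (T M) (hT M)) - pullback ω' (SDC.map T' hT')‖)
      atTop (𝓝 0) := by
  refine tendsto_norm_sub_of_span (SDC.span_monomials C) ?_
  rintro _ ⟨l, rfl⟩
  have key : ∀ {K : Type} [NormedAddCommGroup K] [InnerProductSpace ℂ K] {D : Conjugation K}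
      (ω : SDC D →L[ℂ] ℂ) (T : h →ₗᵢ[ℂ] K) (hT : ∀ ξ, T (C ξ) = D (T ξ)),
      pullback ω (SDC.map T hT) (l.map (SDC.Psi C)).prod
      = ω (List.ofFn fun i => SDC.Psi D (T (l.get i))).prod := by
    intro K _ _ D ω T hT
    have h1 : (List.ofFn fun i => SDC.Psi D (T (l.get i))) = l.map fun ξ => SDC.Psi D (T ξ) := by
      conv_rhs => rw [← List.ofFn_get l, List.map_ofFn]
      rfl
    rw [h1, pullback_apply, map_list_prod, List.map_map]
    rfl
  simp only [key, hω'.eq_pf, fun M => (hω M).eq_pf]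
  refine tendsto_pf fun i j => ?_
  -- The conjugation is moved inside the embedding, so that the entries are two-point functions of
  -- ξ_i and C ξ_j.
  simp only [Matrix.of_apply, ← hT, ← hT', inner_sub_right, LinearIsometry.inner_map_map]
  exact tendsto_const_nhds.sub (hconv _ _)

end QuasiFree

/-! ### Weak convergence of bounded operators -/

theorem IsUnitInterval.norm_le_one {h : Type} [NormedAddCommGroup h] [InnerProductSpace ℂ h]
    [CompleteSpace h] {S : h →L[ℂ] h} (hS : IsUnitInterval S) : ‖S‖ ≤ 1 := by
  have h0 : 0 ≤ S := (ContinuousLinearMap.nonneg_iff_isPositive S).2 hS.1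
  have h1 : S ≤ 1 := hS.2
  exact (CStarAlgebra.norm_le_one_iff_of_nonneg S h0).2 h1

/-- A bounded sequence of functionals which converges on a total set converges pointwise. -/
theorem tendsto_apply_of_span_dense {E : Type*} [NormedAddCommGroup E] [NormedSpace ℂ E]
    {f : ℕ → E →L[ℂ] ℂ} {g : E →L[ℂ] ℂ} {C : ℝ} {s : Set E}
    (hs : (Submodule.span ℂ s).topologicalClosure = ⊤) (hf : ∀ M, ‖f M‖ ≤ C)
    (h : ∀ x ∈ s, Tendsto (fun M => f M x) atTop (𝓝 (g x))) (x : E) :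
    Tendsto (fun M => f M x) atTop (𝓝 (g x)) := by
  have hspan : ∀ y ∈ Submodule.span ℂ s, Tendsto (fun M => f M y) atTop (𝓝 (g y)) := by
    intro y hy
    induction hy using Submodule.span_induction with
    | mem x hx => exact h x hx
    | zero => simp
    | add x y _ _ hx hy => simpa using hx.add hy
    | smul c x _ hx => simpa using hx.const_mul c
  have hC : 0 ≤ C := (norm_nonneg _).trans (hf 0)
  rw [Metric.tendsto_atTop]
  intro ε hε
  have hK : 0 < C + ‖g‖ + 1 := by positivity
  have hx : x ∈ closure (Submodule.span ℂ s : Set E) := by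
    rw [← Submodule.topologicalClosure_coe, hs]
    trivial
  -- The errors of replacing `x` by `y` in `f M` and in `g` add up to at most (C + ‖g‖)‖x - y‖ <
  -- ε/2; the summand 1 keeps the denominator positive.
  obtain ⟨y, hy, hxy⟩ := Metric.mem_closure_iff.1 hx (ε / 2 / (C + ‖g‖ + 1)) (by positivity)
  obtain ⟨M₀, hM₀⟩ := Metric.tendsto_atTop.1 (hspan y hy) (ε / 2) (by positivity)
  refine ⟨M₀, fun M hM => ?_⟩
  rw [dist_eq_norm, lt_div_iff₀ hK] at hxy
  have h1 := hM₀ M hM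
  rw [dist_eq_norm] at h1 ⊢
  have h2 : ‖f M (x - y)‖ ≤ C * ‖x - y‖ := (f M).le_of_opNorm_le (hf M) _
  have h3 : ‖g (x - y)‖ ≤ ‖g‖ * ‖x - y‖ := g.le_opNorm _
  have h4 : f M x - g x = f M (x - y) + (f M y - g y) - g (x - y) := by
    rw [map_sub, map_sub]
    ring
  have h5 := norm_sub_le (f M (x - y) + (f M y - g y)) (g (x - y))
  have h6 := norm_add_le (f M (x - y)) (f M y - g y)
  rw [h4]
  nlinarith [norm_nonneg (x - y)]

/-- A bounded sequence of operators whose matrix elements between the vectors of a total set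
converge is weakly convergent. -/
theorem tendsto_inner_of_span_dense {E : Type*} [NormedAddCommGroup E] [InnerProductSpace ℂ E]
    {T : ℕ → E →L[ℂ] E} {T' : E →L[ℂ] E} {C : ℝ} {s : Set E}
    (hs : (Submodule.span ℂ s).topologicalClosure = ⊤) (hT : ∀ M, ‖T M‖ ≤ C)
    (h : ∀ p ∈ s, ∀ q ∈ s, Tendsto (fun M => ⟪p, T M q⟫_ℂ) atTop (𝓝 ⟪p, T' q⟫_ℂ)) (u v : E) :
    Tendsto (fun M => ⟪u, T M v⟫_ℂ) atTop (𝓝 ⟪u, T' v⟫_ℂ) := by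
  have h1 : ∀ p ∈ s, Tendsto (fun M => ⟪p, T M v⟫_ℂ) atTop (𝓝 ⟪p, T' v⟫_ℂ) := by
    intro p hp
    refine tendsto_apply_of_span_dense (f := fun M => (innerSL ℂ p).comp (T M))
      (g := (innerSL ℂ p).comp T') (C := ‖p‖ * C) hs (fun M => ?_) (h p hp) v
    refine (ContinuousLinearMap.opNorm_comp_le _ _).trans ?_
    rw [innerSL_apply_norm]
    exact mul_le_mul_of_nonneg_left (hT M) (norm_nonneg _)
  -- The inner product is antilinear in its first slot; after conjugation it is a linear functional
  -- of `u` and the same density argument applies.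
  have h2 : Tendsto (fun M => ⟪T M v, u⟫_ℂ) atTop (𝓝 ⟪T' v, u⟫_ℂ) := by
    refine tendsto_apply_of_span_dense (f := fun M => innerSL ℂ (T M v))
      (g := innerSL ℂ (T' v)) (C := C * ‖v‖) hs (fun M => ?_) (fun p hp => ?_) u
    · rw [innerSL_apply_norm]
      exact (T M).le_of_opNorm_le (hT M) v
    · simpa only [innerSL_apply_apply, Function.comp_def, inner_conj_symm] using
        (Complex.continuous_conj.tendsto _).comp (h1 p hp)
  simpa only [Function.comp_def, inner_conj_symm] using (Complex.continuous_conj.tendsto _).comp h2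

/-! ### Fourier coefficients -/

namespace ScalingFunction

variable (φ : ScalingFunction) (V : Volume) {σ : ℤˣ}

/-- The Fourier transform of the scaling function. -/
def fourierTransform (l : ℝ) : ℂ := ∫ x, φ.s x * Complex.exp (-(Complex.I * l * x))

end ScalingFunction

theorem integrable_of_memLp_two {f : ℝ → ℂ} (hf : MemLp f 2) (hc : HasCompactSupport f) :
    Integrable f := by
  have : IsFiniteMeasure (volume.restrict (tsupport f)) :=
    ⟨by rw [Measure.restrict_apply_univ]; exact hc.isCompact.measure_lt_top⟩
  exact (integrableOn_iff_integrable_of_support_subset (subset_tsupport f)).1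
    ((hf.restrict (tsupport f)).integrable (by norm_num))

theorem norm_exp_neg_I_mul (a b : ℝ) : ‖Complex.exp (-(Complex.I * a * b))‖ = 1 := by
  rw [show -(Complex.I * a * b) = ((-(a * b) : ℝ) : ℂ) * Complex.I by push_cast; ring,
    Complex.norm_exp_ofReal_mul_I]

theorem integrable_mul_exp {f : ℝ → ℂ} (hf : MemLp f 2) (hc : HasCompactSupport f) (l : ℝ) :
    Integrable fun x : ℝ => f x * Complex.exp (-(Complex.I * l * x)) := by
  refine (integrable_of_memLp_two hf hc).mul_bdd (c := 1) (by fun_prop) ?_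
  exact Eventually.of_forall fun x => (norm_exp_neg_I_mul l x).le

namespace ScalingFunction

variable (φ : ScalingFunction) (V : Volume) {σ : ℤˣ}

/-- Dominated convergence with the bound |s|, which is integrable because s is square integrable
with compact support; the value at 0 is ∫ s = 1. -/
theorem tendsto_fourierTransform : Tendsto φ.fourierTransform (𝓝 0) (𝓝 1) := by
  have h0 : ∫ x, φ.s x * Complex.exp (-(Complex.I * (0 : ℝ) * x)) = 1 := by
    simp [φ.integral_eq_one]
  rw [← h0]
  refine tendsto_integral_filter_of_dominated_convergence (fun x => ‖φ.s x‖) ?_ ?_ ?_ ?_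
  · exact Eventually.of_forall fun l =>
      (integrable_mul_exp φ.memLp φ.hasCompactSupport l).aestronglyMeasurable
  · refine Eventually.of_forall fun l => Eventually.of_forall fun x => ?_
    rw [norm_mul, norm_exp_neg_I_mul, mul_one]
  · exact (integrable_of_memLp_two φ.memLp φ.hasCompactSupport).norm
  · refine Eventually.of_forall fun x => ?_
    have : Continuous fun l : ℝ => φ.s x * Complex.exp (-(Complex.I * l * x)) := by fun_prop
    exact this.tendsto 0

/-- The substitution x = (y - ε_N z)/ε_N has Jacobian ε_N, which turns the normalization ε_N^{-1/2}
into √ε_N; the translation produces the phase. -/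
theorem integral_atom_mul_exp (N : ℕ) (z : ℤ) (k : ℝ) :
    ∫ y : ℝ, φ.atom V N z y * Complex.exp (-(Complex.I * k * y))
      = (√(V.eps N) : ℝ) * φ.fourierTransform (V.eps N * k)
        * Complex.exp (-(Complex.I * k * (V.eps N * z))) := by
  have he := V.eps_pos N
  set F : ℝ → ℂ := fun x => φ.s x * Complex.exp (-(Complex.I * ((V.eps N * k : ℝ) : ℂ) * x)) with hF
  have h1 : ∀ y : ℝ, φ.atom V N z y * Complex.exp (-(Complex.I * k * y))
      = ((√(V.eps N))⁻¹ : ℝ) * Complex.exp (-(Complex.I * k * (V.eps N * z)))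
        * F ((V.eps N)⁻¹ * (y - V.eps N * z)) := by
    intro y
    have h2 : Complex.exp (-(Complex.I * k * y)) = Complex.exp (-(Complex.I * k * (V.eps N * z)))
        * Complex.exp (-(Complex.I * ((V.eps N * k : ℝ) : ℂ)
          * (((V.eps N)⁻¹ * (y - V.eps N * z) : ℝ) : ℂ))) := by
      rw [← Complex.exp_add]
      congr 1
      have : (V.eps N : ℂ) ≠ 0 := by exact_mod_cast he.ne'
      push_cast
      field_simp
      ring
    rw [h2, hF, atom]
    ring
  simp_rw [h1]
  rw [integral_const_mul, integral_sub_right_eq_self (fun y => F ((V.eps N)⁻¹ * y)),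
    Measure.integral_comp_mul_left F, inv_inv, abs_of_pos he, Complex.real_smul,
    show ∫ y, F y = φ.fourierTransform (V.eps N * k) from rfl]
  have hs : ((√(V.eps N))⁻¹ : ℝ) * V.eps N = √(V.eps N) := by
    rw [inv_mul_eq_div, Real.div_sqrt]
  conv_rhs => rw [← hs]
  push_cast
  ring

end ScalingFunction

section Momentum

variable {V : Volume} {σ : ℤˣ}

/-- The phase is exp(-2πi m(n + θ)), which is 1 for θ = 0 and (-1)^m for θ = 1/2. Thus plane waves
with momenta in Γ_∞ obey the boundary condition of the fields. -/
theorem exp_momentum {k : ℝ} (hk : k ∈ contMomenta V σ) (m : ℤ) :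
    Complex.exp (-(Complex.I * k * (2 * V.L * m))) = sgn σ m := by
  obtain ⟨n, rfl⟩ := hk
  have hL : (V.L : ℂ) ≠ 0 := by exact_mod_cast V.L_pos.ne'
  rcases Int.units_eq_one_or σ with rfl | rfl
  · rw [show -(Complex.I * ((Real.pi / V.L * (n + shift 1) : ℝ) : ℂ) * (2 * V.L * m))
      = ((-(n * m) : ℤ) : ℂ) * (2 * Real.pi * Complex.I) by
        simp only [shift, if_true]; push_cast; field_simp; ring, Complex.exp_int_mul_two_pi_mul_I]
    simp [sgn]
  · rw [show -(Complex.I * ((Real.pi / V.L * (n + shift (-1)) : ℝ) : ℂ) * (2 * V.L * m))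
      = ((-(n * m) : ℤ) : ℂ) * (2 * Real.pi * Complex.I)
        + ((-m : ℤ) : ℂ) * (Real.pi * Complex.I) by
        simp only [shift, if_neg (by decide : ¬((-1 : ℤˣ) = 1))]; push_cast; field_simp; ring,
      Complex.exp_add, Complex.exp_int_mul_two_pi_mul_I, Complex.exp_int_mul, Complex.exp_pi_mul_I,
      one_mul, zpow_neg, ← inv_zpow, inv_neg_one]
    rcases Int.even_or_odd m with hm | hm
    · simp [sgn, hm.neg_one_zpow]
    · simp [sgn, hm.neg_one_zpow]

/-- Unfolding of the Fourier coefficients of a superposition of translates. -/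
theorem integral_periodize_mul_exp {f : ℝ → ℂ} (hf : MemLp f 2) (hc : HasCompactSupport f)
    {k : ℝ} (hk : k ∈ contMomenta V σ) :
    ∫ y in Set.Ioc (-V.L) V.L, periodize V.L σ f y * Complex.exp (-(Complex.I * k * y))
      = ∫ y : ℝ, f y * Complex.exp (-(Complex.I * k * y)) := by
  have hL := V.L_pos
  set F : ℝ → ℂ := fun y => f y * Complex.exp (-(Complex.I * k * y)) with hF
  have hFint : Integrable F := integrable_mul_exp hf hc k
  have hdom := isAddFundamentalDomain_Ioc (T := 2 * V.L) (by positivity) (-V.L)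
  rw [show -V.L + 2 * V.L = V.L by ring] at hdom
  obtain ⟨M, hM⟩ := exists_bound hL hc V.L
  let e : ℤ ≃ AddSubgroup.zmultiples (2 * V.L) :=
    Equiv.ofBijective (fun n => ⟨n • (2 * V.L), n, rfl⟩)
      ⟨fun a b hab => by
        have := congrArg Subtype.val hab
        simpa [hL.ne'] using this, by
        rintro ⟨_, n, rfl⟩
        exact ⟨n, rfl⟩⟩
  -- Translating the plane wave by 2Lm yields the sign σ^m, which is exactly the weight of the m-th
  -- translate in `periodize`.
  have he : ∀ (m : ℤ) (y : ℝ), F (e m +ᵥ y)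
      = sgn σ m * f (y + 2 * V.L * m) * Complex.exp (-(Complex.I * k * y)) := by
    intro m y
    have h1 : (e m +ᵥ y : ℝ) = y + 2 * V.L * m := by
      change m • (2 * V.L) + y = _
      rw [zsmul_eq_mul]
      ring
    rw [h1, hF]
    simp only
    rw [show -(Complex.I * k * ((y + 2 * V.L * m : ℝ) : ℂ))
      = -(Complex.I * k * y) + -(Complex.I * k * (2 * V.L * m)) by push_cast; ring,
      Complex.exp_add, exp_momentum hk]
    ring
  have hint : ∀ m : ℤ, IntegrableOn (fun y : ℝ => F (e m +ᵥ y)) (Set.Ioc (-V.L) V.L) := by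
    intro m
    have : (fun y : ℝ => F (e m +ᵥ y)) = fun y => F (y + (e m : ℝ)) := by
      funext y
      rw [add_comm]
      rfl
    rw [this]
    exact (hFint.comp_add_right _).integrableOn
  -- Only the translates with |m| ≤ M can be nonzero on (-L, L], so the sum is finite and commutes
  -- with the integral.
  rw [hdom.integral_eq_tsum'' F hFint, ← e.tsum_eq,
    tsum_eq_sum (s := Finset.Icc (-(M : ℤ)) M), ← integral_finsetSum _ fun m _ => hint m]
  · refine setIntegral_congr_fun measurableSet_Ioc fun y hy => ?_
    simp only [he, periodize_eq_sum σ (hM y (Set.Ioc_subset_Icc_self hy)), Finset.sum_mul]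
  · intro m hm
    refine setIntegral_eq_zero_of_forall_eq_zero fun y hy => ?_
    rw [he, hM y (Set.Ioc_subset_Icc_self hy) m hm, mul_zero, zero_mul]

theorem conj_exp_I_mul (k y : ℝ) :
    conj (Complex.exp (Complex.I * k * y)) = Complex.exp (-(Complex.I * k * y)) := by
  rw [← Complex.exp_conj]
  simp

theorem inner_contPlaneWave (k : ℝ) (f : V.ContScalar) : ⟪contPlaneWave V k, f⟫_ℂ
    = ∫ y in Set.Ioc (-V.L) V.L, f y * Complex.exp (-(Complex.I * k * y)) := by
  rw [L2.inner_def]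
  refine integral_congr_ae ?_
  filter_upwards [(memLp_planeWave V k).coeFn_toLp] with y hy
  rw [RCLike.inner_apply, contPlaneWave, hy, conj_exp_I_mul]

theorem inner_contPlaneWave_wave (φ : ScalingFunction) (N : ℕ) (z : ℤ) {k : ℝ}
    (hk : k ∈ contMomenta V σ) : ⟪contPlaneWave V k, φ.wave V σ N z⟫_ℂ
      = (√(V.eps N) : ℝ) * φ.fourierTransform (V.eps N * k)
        * Complex.exp (-(Complex.I * k * (V.eps N * z))) := by
  rw [inner_contPlaneWave, ← φ.integral_atom_mul_exp,
    ← integral_periodize_mul_exp (φ.memLp_atom V N z) (φ.hasCompactSupport_atom V N z) hk]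
  refine integral_congr_ae ?_
  filter_upwards [φ.coeFn_wave V σ N z] with y hy
  rw [hy]

/-- Every site contributes the same factor √ε_N ŝ(ε_N k) and its own phase e^{-ikx}; the phases
assemble to the lattice Fourier coefficient. -/
theorem inner_contPlaneWave_toCont (φ : ScalingFunction) (N : ℕ) (η : V.LatticeScalar N) {k : ℝ}
    (hk : k ∈ contMomenta V σ) : ⟪contPlaneWave V k, φ.toCont V σ N η⟫_ℂ
      = (√(V.eps N) : ℝ) * φ.fourierTransform (V.eps N * k) * ⟪latticePlaneWave V N k, η⟫_ℂ := by
  rw [φ.toCont_apply, inner_sum, PiLp.inner_apply, Finset.mul_sum]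
  refine Finset.sum_congr rfl fun x _ => ?_
  have h := conj_exp_I_mul k (V.eps N * (x : ℤ))
  push_cast at h
  rw [inner_smul_right, inner_contPlaneWave_wave φ N x hk, RCLike.inner_apply, latticePlaneWave, h]
  ring

/-- The plane waves are total. -/
theorem eq_zero_of_inner_contPlaneWave {f : V.ContScalar}
    (hf : ∀ k ∈ contMomenta V σ, ⟪contPlaneWave V k, f⟫_ℂ = 0) : f = 0 := by
  have hL := V.L_pos
  have hab : -V.L < V.L := by linarith
  -- Multiplication by e^{-iay} moves the momenta to (π/L)ℤ and preserves moduli, which reduces both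
  -- boundary conditions to ordinary Fourier series.
  set a : ℝ := Real.pi / V.L * shift σ with ha
  set F : ℝ → ℂ := fun y => f y * Complex.exp (-(Complex.I * a * y)) with hF
  have hnorm : ∀ y, ‖F y‖ = ‖f y‖ := fun y => by
    rw [hF, norm_mul, norm_exp_neg_I_mul, mul_one]
  have hmem : MemLp F 2 (volume.restrict (Set.Ioc (-V.L) V.L)) := by
    refine (Lp.memLp f).of_le ?_ (Eventually.of_forall fun y => (hnorm y).le)
    exact (Lp.aestronglyMeasurable f).mul (by fun_prop)
  have hcoef : ∀ n, fourierCoeffOn hab F n = 0 := by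
    intro n
    have h1 := hf (Real.pi / V.L * (n + shift σ)) ⟨n, rfl⟩
    rw [inner_contPlaneWave] at h1
    rw [fourierCoeffOn_eq_integral, intervalIntegral.integral_of_le hab.le]
    rw [← smul_zero (1 / (V.L - -V.L)), ← h1]
    congr 1
    refine setIntegral_congr_fun measurableSet_Ioc fun y _ => ?_
    simp only [hF, fourier_coe_apply, smul_eq_mul]
    rw [mul_left_comm, ← Complex.exp_add]
    congr 2
    have : (V.L : ℂ) ≠ 0 := by exact_mod_cast hL.ne'
    rw [ha]
    push_cast
    field_simp
    ring
  -- Parseval's identity: vanishing coefficients force ∫ |f|² = 0.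
  have h1 := hasSum_sq_fourierCoeffOn hab hmem
  simp only [hcoef, norm_zero, ne_eq, OfNat.ofNat_ne_zero, not_false_eq_true, zero_pow] at h1
  have h2 := h1.unique hasSum_zero
  have h3 : ∫ y in Set.Ioc (-V.L) V.L, ‖f y‖ ^ 2 = 0 := by
    rw [intervalIntegral.integral_of_le hab.le] at h2
    simp only [hnorm] at h2
    refine (smul_eq_zero.1 h2).resolve_left ?_
    have : 0 < V.L - -V.L := by linarith
    positivity
  rw [← inner_self_eq_zero (𝕜 := ℂ), L2.inner_def]
  have h4 : ∀ y, ⟪f y, f y⟫_ℂ = ((‖f y‖ ^ 2 : ℝ) : ℂ) := fun y => by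
    rw [inner_self_eq_norm_sq_to_K]
    norm_cast
  simp only [h4]
  rw [integral_complex_ofReal, h3, Complex.ofReal_zero]

theorem inner_component {K : Type} [NormedAddCommGroup K] [InnerProductSpace ℂ K] (u : K)
    (j : Fin 2) (ξ : Spinor K) : ⟪component u j, ξ⟫_ℂ = ⟪u, ξ j⟫_ℂ := by
  fin_cases j <;> simp [component, PiLp.inner_apply]

/-- In a Hilbert space a set is total if its orthogonal complement is trivial, and this can be
checked in each component. -/
theorem span_planeWaves (V : Volume) (σ : ℤˣ) :
    (Submodule.span ℂ {p : ContSpace V | ∃ k ∈ contMomenta V σ, ∃ j,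
      p = component (contPlaneWave V k) j}).topologicalClosure = ⊤ := by
  rw [Submodule.topologicalClosure_eq_top_iff, Submodule.eq_bot_iff]
  intro ξ hξ
  ext1 j
  refine eq_zero_of_inner_contPlaneWave (σ := σ) fun k hk => ?_
  rw [← inner_component]
  exact (Submodule.mem_orthogonal _ _).1 hξ _ (Submodule.subset_span ⟨k, hk, j, rfl⟩)

theorem eventually_mem_latticeMomenta {k : ℝ} (hk : k ∈ contMomenta V σ) :
    ∀ᶠ N in atTop, k ∈ latticeMomenta V σ N := by
  obtain ⟨n, rfl⟩ := hk
  -- The chain |n| < N < 2^N ≤ L_N places n strictly inside the window of lattice momenta.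
  filter_upwards [eventually_gt_atTop n.natAbs] with N hN
  have h1 : N < 2 ^ N := Nat.lt_two_pow_self
  have h2 : 2 ^ N ≤ V.size N := Nat.le_mul_of_pos_right _ V.L0_pos
  exact ⟨n, by omega, by omega, rfl⟩

theorem tendsto_eps (V : Volume) : Tendsto V.eps atTop (𝓝 0) := by
  have h : V.eps = fun N => V.L / V.L0 * (1 / 2 : ℝ) ^ N := by
    funext N
    simp only [Volume.eps, Volume.size]
    push_cast
    rw [one_div, inv_pow]
    field_simp
  rw [h]
  simpa using (tendsto_pow_atTop_nhds_zero_of_lt_one (by norm_num : (0 : ℝ) ≤ 1 / 2)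
    (by norm_num)).const_mul (V.L / V.L0)

/-! ### Two-point functions -/

theorem rgCont_rgLattice (φ : ScalingFunction) (N M : ℕ) (ξ : LatticeSpace V N) :
    rgCont φ V σ (N + M) (rgLattice φ V σ N M ξ) = rgCont φ V σ N ξ := by
  ext1 j
  exact φ.toCont_steps V σ N M (ξ j)

variable (V σ) in
/-- The adjoint of `R^N_∞`. -/
def rgContAdjoint (φ : ScalingFunction) (N : ℕ) : ContSpace V →L[ℂ] LatticeSpace V N :=
  ContinuousLinearMap.adjoint (rgCont φ V σ N).toContinuousLinearMap

theorem rgContAdjoint_inner_left (φ : ScalingFunction) (N : ℕ) (u : ContSpace V)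
    (ξ : LatticeSpace V N) : ⟪rgContAdjoint V σ φ N u, ξ⟫_ℂ = ⟪u, rgCont φ V σ N ξ⟫_ℂ :=
  ContinuousLinearMap.adjoint_inner_left _ _ _

theorem norm_rgContAdjoint_le (φ : ScalingFunction) (N : ℕ) : ‖rgContAdjoint V σ φ N‖ ≤ 1 := by
  rw [rgContAdjoint, LinearIsometryEquiv.norm_map]
  exact LinearIsometry.norm_toContinuousLinearMap_le _

theorem rgContAdjoint_rgCont (φ : ScalingFunction) (N : ℕ) (ξ : LatticeSpace V N) :
    rgContAdjoint V σ φ N (rgCont φ V σ N ξ) = ξ := by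
  refine ext_inner_right ℂ fun η => ?_
  rw [rgContAdjoint_inner_left, LinearIsometry.inner_map_map]

/-- Dual form of `inner_contPlaneWave_toCont`. It shows that R^N_∞ respects momentum, so the
diagonal form of the lattice operators passes to the continuum plane waves. -/
theorem rgContAdjoint_planeWave (φ : ScalingFunction) (N : ℕ) {k : ℝ} (hk : k ∈ contMomenta V σ)
    (j : Fin 2) : rgContAdjoint V σ φ N (component (contPlaneWave V k) j)
      = ((√(V.eps N) : ℝ) * conj (φ.fourierTransform (V.eps N * k)))
        • component (latticePlaneWave V N k) j := by
  refine ext_inner_right ℂ fun η => ?_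
  rw [rgContAdjoint_inner_left, inner_component, inner_smul_left, inner_component, map_mul,
    Complex.conj_conj, Complex.conj_ofReal]
  exact inner_contPlaneWave_toCont φ N (η j) hk

/-- Convergence of the two-point functions along the renormalization group flow. -/
theorem tendsto_twoPoint (φ : ScalingFunction) {S : ∀ N, LatticeSpace V N →L[ℂ] LatticeSpace V N}
    {S' : ContSpace V →L[ℂ] ContSpace V} {s : ℕ → ℝ → Matrix (Fin 2) (Fin 2) ℂ}
    {s' : ℝ → Matrix (Fin 2) (Fin 2) ℂ} (hS : ∀ N, IsUnitInterval (S N))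
    (hk : ∀ N, LatticeKernel V σ N (S N) (s N)) (hk' : ContKernel V σ S' s')
    (hs : ∀ k ∈ contMomenta V σ, ∀ i j : Fin 2,
      Tendsto (fun N => s N k i j) atTop (𝓝 (s' k i j)))
    (N : ℕ) (ξ η : LatticeSpace V N) :
    Tendsto (fun M => ⟪rgLattice φ V σ N M ξ, S (N + M) (rgLattice φ V σ N M η)⟫_ℂ) atTop
      (𝓝 ⟪rgCont φ V σ N ξ, S' (rgCont φ V σ N η)⟫_ℂ) := by
  -- Conjugation by R^N_∞ places the operators of all scales on one Hilbert space, where weak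
  -- convergence makes sense.
  set T : ℕ → ContSpace V →L[ℂ] ContSpace V := fun N =>
    (rgCont φ V σ N).toContinuousLinearMap.comp ((S N).comp (rgContAdjoint V σ φ N)) with hT
  have hTinner : ∀ N u v, ⟪u, T N v⟫_ℂ
      = ⟪rgContAdjoint V σ φ N u, S N (rgContAdjoint V σ φ N v)⟫_ℂ := fun N u v =>
    (rgContAdjoint_inner_left φ N u _).symm
  have hTnorm : ∀ N, ‖T N‖ ≤ 1 := by
    intro N
    refine ContinuousLinearMap.opNorm_le_bound _ zero_le_one fun v => ?_
    have h1 := (rgContAdjoint V σ φ N).le_of_opNorm_le (norm_rgContAdjoint_le φ N) v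
    have h2 := (S N).le_of_opNorm_le (hS N).norm_le_one (rgContAdjoint V σ φ N v)
    calc ‖T N v‖ = ‖S N (rgContAdjoint V σ φ N v)‖ := (rgCont φ V σ N).norm_map _
      _ ≤ 1 * ‖v‖ := by linarith
  have hmat : ∀ u v, Tendsto (fun N => ⟪u, T N v⟫_ℂ) atTop (𝓝 ⟪u, S' v⟫_ℂ) := by
    refine tendsto_inner_of_span_dense (span_planeWaves V σ) hTnorm ?_
    rintro _ ⟨k, hkm, i, rfl⟩ _ ⟨l, hlm, j, rfl⟩
    have hfour : ∀ k : ℝ, Tendsto (fun N => φ.fourierTransform (V.eps N * k)) atTop (𝓝 1) :=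
      fun k => φ.tendsto_fourierTransform.comp (by simpa using (tendsto_eps V).mul_const k)
    -- The lattice kernel is prescribed only on Γ_N, so this formula waits until both momenta lie in
    -- Γ_N.
    have hev : ∀ᶠ N in atTop, φ.fourierTransform (V.eps N * k)
        * conj (φ.fourierTransform (V.eps N * l)) * (open Classical in
          if k = l then 2 * V.L * s N k i j else 0)
        = ⟪component (contPlaneWave V k) i, T N (component (contPlaneWave V l) j)⟫_ℂ := by
      filter_upwards [eventually_mem_latticeMomenta hkm, eventually_mem_latticeMomenta hlm]
        with N hkN hlN
      rw [hTinner, rgContAdjoint_planeWave φ N hkm, rgContAdjoint_planeWave φ N hlm, map_smul,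
        inner_smul_left, inner_smul_right, hk N k hkN l hlN i j, map_mul, Complex.conj_conj,
        Complex.conj_ofReal]
      split_ifs with hkl
      -- The factors √ε_N from the two adjoints turn the lattice normalization 2L_N into the
      -- continuum normalization 2L.
      · have h1 : ((√(V.eps N) : ℝ) : ℂ) * (√(V.eps N) : ℝ) * V.size N = V.L := by
          rw [← Complex.ofReal_mul, Real.mul_self_sqrt (V.eps_pos N).le]
          exact_mod_cast V.eps_mul_size N
        rw [← h1]
        ring
      · simp
    refine Tendsto.congr' hev ?_
    rw [hk' k hkm l hlm i j]
    have h1 : Tendsto (fun N => φ.fourierTransform (V.eps N * k)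
        * conj (φ.fourierTransform (V.eps N * l))) atTop (𝓝 1) := by
      simpa using (hfour k).mul ((Complex.continuous_conj.tendsto _).comp (hfour l))
    split_ifs with hkl
    · simpa using h1.mul ((hs k hkm i j).const_mul (2 * V.L : ℂ))
    · simp
  -- Here R^*R = 1 at scale `N + M` removes the adjoints, and compatibility of the embeddings leaves
  -- vectors independent of `M`.
  have hfix : ∀ M, ⟪rgLattice φ V σ N M ξ, S (N + M) (rgLattice φ V σ N M η)⟫_ℂ
      = ⟪rgCont φ V σ N ξ, T (N + M) (rgCont φ V σ N η)⟫_ℂ := by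
    intro M
    rw [hTinner, ← rgCont_rgLattice φ N M ξ, ← rgCont_rgLattice φ N M η, rgContAdjoint_rgCont,
      rgContAdjoint_rgCont]
  simp only [hfix]
  exact (hmat _ _).comp (tendsto_atTop_mono (fun M => Nat.le_add_left M N) tendsto_id)

end Momentum

/-! ### Convergence of the vacuum kernels -/

section Kernels

variable {V : Volume} {σ : ℤˣ} {lam : ℕ → ℝ} {m : ℝ}

/-- The quotient H/ω is unchanged when both are divided by ε. The rescaled numerator and denominator
converge separately, and the limit of the latter is nonzero. -/
theorem tendsto_negativeEnergy {ε ω : ℕ → ℝ} {ω' : ℝ} {H : ℕ → Matrix (Fin 2) (Fin 2) ℂ}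
    {H' : Matrix (Fin 2) (Fin 2) ℂ} (hε : ∀ N, 0 < ε N)
    (hH : ∀ i j, Tendsto (fun N => ((ε N)⁻¹ : ℝ) * H N i j) atTop (𝓝 (H' i j)))
    (hω : Tendsto (fun N => (ε N)⁻¹ * ω N) atTop (𝓝 ω')) (h0 : ω' ≠ 0) (i j : Fin 2) :
    Tendsto (fun N => negativeEnergy (H N) (ω N) i j) atTop (𝓝 (negativeEnergy H' ω' i j)) := by
  simp only [negativeEnergy, Matrix.smul_apply, Matrix.sub_apply, smul_eq_mul]
  refine (tendsto_const_nhds.sub ?_).const_mul _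
  have h1 : Tendsto (fun N => ((((ε N)⁻¹ * ω N)⁻¹ : ℝ) : ℂ) * (((ε N)⁻¹ : ℝ) * H N i j)) atTop
      (𝓝 ((ω'⁻¹ : ℝ) * H' i j)) :=
    ((Complex.continuous_ofReal.tendsto _).comp (hω.inv₀ h0)).mul (hH i j)
  -- Cancelling ε is legitimate also where `ω N` vanishes, since both sides are then 0 by the
  -- convention 0⁻¹ = 0.
  refine h1.congr fun N => ?_
  have : (ε N : ℂ) ≠ 0 := by exact_mod_cast (hε N).ne'
  push_cast
  rw [mul_inv, inv_inv]
  field_simp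

theorem tendsto_eps_nhdsNE (V : Volume) : Tendsto V.eps atTop (𝓝[≠] 0) :=
  tendsto_nhdsWithin_iff.2 ⟨tendsto_eps V, Eventually.of_forall fun N => (V.eps_pos N).ne'⟩

/-- This is the derivative of t ↦ e^{ct} at 0, read along the nonzero sequence ε_N → 0. -/
theorem tendsto_exp_sub_one_div_eps (V : Volume) (c : ℂ) :
    Tendsto (fun N => ((V.eps N)⁻¹ : ℝ) * (Complex.exp (c * V.eps N) - 1)) atTop (𝓝 c) := by
  have h1 : HasDerivAt (fun t : ℝ => Complex.exp (c * t)) c 0 := by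
    have h2 : HasDerivAt (fun t : ℝ => c * (t : ℂ)) c 0 := by
      simpa using (Complex.ofRealCLM.hasDerivAt (x := (0 : ℝ))).const_mul c
    simpa using h2.cexp
  have h3 := (hasDerivAt_iff_tendsto_slope_zero.1 h1).comp (tendsto_eps_nhdsNE V)
  simpa [Function.comp_def] using h3

theorem tendsto_sin_div_eps (V : Volume) (k : ℝ) :
    Tendsto (fun N => (V.eps N)⁻¹ * Real.sin (V.eps N * k / 2)) atTop (𝓝 (k / 2)) := by
  have h1 : HasDerivAt (fun t : ℝ => Real.sin (t * k / 2)) (k / 2) 0 := by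
    have h2 : HasDerivAt (fun t : ℝ => t * k / 2) (k / 2) 0 := by
      simpa using ((hasDerivAt_id (0 : ℝ)).mul_const k).div_const 2
    simpa using h2.sin
  have h3 := (hasDerivAt_iff_tendsto_slope_zero.1 h1).comp (tendsto_eps_nhdsNE V)
  simpa [Function.comp_def] using h3

theorem tendsto_diracSymbol (hlam : Tendsto (fun N => (V.eps N)⁻¹ * lam N) atTop (𝓝 m)) (k : ℝ)
    (i j : Fin 2) : Tendsto (fun N => ((V.eps N)⁻¹ : ℝ) * diracSymbol (V.eps N) (lam N) k i j) atTop
      (𝓝 (diracSymbolCont m k i j)) := by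
  have h0 : Tendsto (fun N => ((V.eps N)⁻¹ : ℝ) * (lam N : ℂ)) atTop (𝓝 (m : ℂ)) := by
    simpa [Function.comp_def] using (Complex.continuous_ofReal.tendsto _).comp hlam
  fin_cases i <;> fin_cases j
  · simpa [diracSymbol, diracSymbolCont] using h0
  · simpa [diracSymbol, diracSymbolCont] using tendsto_exp_sub_one_div_eps V (-(Complex.I * k))
  · simpa [diracSymbol, diracSymbolCont] using tendsto_exp_sub_one_div_eps V (Complex.I * k)
  · simpa [diracSymbol, diracSymbolCont] using h0.neg

theorem tendsto_majoranaSymbol (hlam : Tendsto (fun N => (V.eps N)⁻¹ * lam N) atTop (𝓝 m)) (k : ℝ)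
    (i j : Fin 2) :
    Tendsto (fun N => ((V.eps N)⁻¹ : ℝ) * majoranaSymbol (V.eps N) (lam N) k i j) atTop
      (𝓝 (majoranaSymbolCont m k i j)) := by
  have h0 : Tendsto (fun N => ((V.eps N)⁻¹ : ℝ) * (lam N : ℂ)) atTop (𝓝 (m : ℂ)) := by
    simpa [Function.comp_def] using (Complex.continuous_ofReal.tendsto _).comp hlam
  fin_cases i <;> fin_cases j
  · simp [majoranaSymbol, majoranaSymbolCont]
  · simpa [majoranaSymbol, majoranaSymbolCont, mul_add, sub_eq_add_neg] using
      h0.add (tendsto_exp_sub_one_div_eps V (-(Complex.I * k)))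
  · simpa [majoranaSymbol, majoranaSymbolCont, mul_add] using
      h0.add (tendsto_exp_sub_one_div_eps V (Complex.I * k))
  · simp [majoranaSymbol, majoranaSymbolCont]

theorem inv_eps_mul_sqrt (V : Volume) (N : ℕ) (x : ℝ) :
    (V.eps N)⁻¹ * √x = √((V.eps N)⁻¹ ^ 2 * x) := by
  rw [Real.sqrt_mul (sq_nonneg _), Real.sqrt_sq (inv_nonneg.2 (V.eps_pos N).le)]

theorem tendsto_diracDispersion (hlam : Tendsto (fun N => (V.eps N)⁻¹ * lam N) atTop (𝓝 m))
    (k : ℝ) : Tendsto (fun N => (V.eps N)⁻¹ * diracDispersion (V.eps N) (lam N) k) atTop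
      (𝓝 (contDispersion m k)) := by
  simp only [diracDispersion, contDispersion, inv_eps_mul_sqrt]
  refine (Real.continuous_sqrt.tendsto _).comp ?_
  have h := (hlam.pow 2).add (((tendsto_sin_div_eps V k).pow 2).const_mul 4)
  rw [show m ^ 2 + 4 * (k / 2) ^ 2 = m ^ 2 + k ^ 2 by ring] at h
  exact h.congr fun N => by ring

theorem tendsto_majoranaDispersion (hlam : Tendsto (fun N => (V.eps N)⁻¹ * lam N) atTop (𝓝 m))
    (k : ℝ) : Tendsto (fun N => (V.eps N)⁻¹ * majoranaDispersion (V.eps N) (lam N) k) atTop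
      (𝓝 (contDispersion m k)) := by
  simp only [majoranaDispersion, contDispersion, inv_eps_mul_sqrt]
  refine (Real.continuous_sqrt.tendsto _).comp ?_
  -- The dispersion is |λ + e^{iεk} - 1|, whose square contains the extra term -4λ sin²(εk/2). After
  -- rescaling it still vanishes, because λ_N = ε_N (λ_N/ε_N) → 0.
  have h0 : Tendsto lam atTop (𝓝 0) := by
    have h1 := (tendsto_eps V).mul hlam
    rw [zero_mul] at h1
    refine h1.congr fun N => ?_
    rw [mul_inv_cancel_left₀ (V.eps_pos N).ne']
  have h2 : Tendsto (fun N => 4 * (1 - lam N)) atTop (𝓝 4) := by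
    simpa using (h0.const_sub 1).const_mul 4
  have h := (hlam.pow 2).add (h2.mul ((tendsto_sin_div_eps V k).pow 2))
  rw [show m ^ 2 + 4 * (k / 2) ^ 2 = m ^ 2 + k ^ 2 by ring] at h
  exact h.congr fun N => by ring

theorem contDispersion_eq_zero {m k : ℝ} (h : contDispersion m k = 0) : m = 0 ∧ k = 0 := by
  rw [contDispersion, Real.sqrt_eq_zero (by positivity)] at h
  exact ⟨by nlinarith [sq_nonneg m, sq_nonneg k], by nlinarith [sq_nonneg m, sq_nonneg k]⟩

/-- A zero anti-periodic momentum would require 2n + 1 = 0. Hence zero modes occur for periodic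
boundary conditions only. -/
theorem eq_one_of_zero_mem_contMomenta (h : (0 : ℝ) ∈ contMomenta V σ) : σ = 1 := by
  by_contra hσ
  obtain ⟨n, hn⟩ := h
  rw [shift, if_neg hσ, zero_eq_mul] at hn
  rcases hn with hn | hn
  · exact (div_pos Real.pi_pos V.L_pos).ne' hn
  · have h1 : ((2 * n + 1 : ℤ) : ℝ) = 0 := by push_cast; linarith
    have h2 : 2 * n + 1 = 0 := by exact_mod_cast h1
    omega

/-- Convergence of the vacuum kernels, from the convergence of the rescaled Hamiltonians. At
vanishing energy the kernels are eventually equal. -/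
theorem tendsto_vacuumKernel {H : ℝ → ℝ → ℝ → Matrix (Fin 2) (Fin 2) ℂ} {D : ℝ → ℝ → ℝ → ℝ}
    {H' : ℝ → ℝ → Matrix (Fin 2) (Fin 2) ℂ}
    (hH : ∀ k i j, Tendsto (fun N => ((V.eps N)⁻¹ : ℝ) * H (V.eps N) (lam N) k i j) atTop
      (𝓝 (H' m k i j)))
    (hD : ∀ k, Tendsto (fun N => (V.eps N)⁻¹ * D (V.eps N) (lam N) k) atTop
      (𝓝 (contDispersion m k)))
    (hH0 : ∀ ε, H ε 0 0 = 0) (hH0' : H' 0 0 = 0)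
    (hm : m = 0 → σ = 1 → ∀ᶠ N in atTop, lam N = 0) :
    ∀ k ∈ contMomenta V σ, ∀ i j : Fin 2,
      Tendsto (fun N => negativeEnergy (H (V.eps N) (lam N) k) (D (V.eps N) (lam N) k) i j) atTop
        (𝓝 (negativeEnergy (H' m k) (contDispersion m k) i j)) := by
  intro k hk i j
  by_cases h0 : contDispersion m k = 0
  -- Both Hamiltonians vanish at this zero mode once λ_N = 0, so both kernels are 1/2.
  · obtain ⟨rfl, rfl⟩ := contDispersion_eq_zero h0
    refine tendsto_const_nhds.congr' ?_
    filter_upwards [hm rfl (eq_one_of_zero_mem_contMomenta hk)] with N hN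
    simp only [negativeEnergy, hN, hH0, hH0', smul_zero]
  · exact tendsto_negativeEnergy V.eps_pos (hH k) (hD k) h0 i j

theorem diracSymbol_zero (ε : ℝ) : diracSymbol ε 0 0 = 0 := by
  ext i j
  fin_cases i <;> fin_cases j <;> simp [diracSymbol]

theorem majoranaSymbol_zero (ε : ℝ) : majoranaSymbol ε 0 0 = 0 := by
  ext i j
  fin_cases i <;> fin_cases j <;> simp [majoranaSymbol]

theorem diracSymbolCont_zero : diracSymbolCont 0 0 = 0 := by
  ext i j
  fin_cases i <;> fin_cases j <;> simp [diracSymbolCont]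

theorem majoranaSymbolCont_zero : majoranaSymbolCont 0 0 = 0 := by
  ext i j
  fin_cases i <;> fin_cases j <;> simp [majoranaSymbolCont]

end Kernels

/-! ### Convergence of states along the renormalization group flow -/

section Flow

variable {V : Volume} {σ : ℤˣ} (φ : ScalingFunction) {s : ℕ → ℝ → Matrix (Fin 2) (Fin 2) ℂ}
  {slim : ℝ → Matrix (Fin 2) (Fin 2) ℂ}

theorem tendsto_carFlow {ω : ∀ N, CAR (LatticeSpace V N) →L[ℂ] ℂ}
    {ωlim : CAR (ContSpace V) →L[ℂ] ℂ} (hω : ∀ N, IsLatticeCARState V σ N (s N) (ω N))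
    (hlim : IsContCARState V σ slim ωlim)
    (hs : ∀ k ∈ contMomenta V σ, ∀ i j : Fin 2,
      Tendsto (fun N => s N k i j) atTop (𝓝 (slim k i j))) (N : ℕ) :
    Tendsto (fun M => ‖pullback (ω (N + M)) (carLattice φ V σ N M)
      - pullback ωlim (carCont φ V σ N)‖) atTop (𝓝 0) := by
  choose S hS hk hq using hω
  obtain ⟨S', _, hk', hq'⟩ := hlim
  exact CAR.tendsto_norm_pullback (fun M => hq (N + M)) hq' (tendsto_twoPoint φ hS hk hk' hs N)

variable {φ} in
theorem tendsto_sdcFlow (hφ : φ.IsReal) {ω : ∀ N, SDC (latticeCharge V N) →L[ℂ] ℂ}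
    {ωlim : SDC (contCharge V) →L[ℂ] ℂ} (hω : ∀ N, IsLatticeSDCState V σ N (s N) (ω N))
    (hlim : IsContSDCState V σ slim ωlim)
    (hs : ∀ k ∈ contMomenta V σ, ∀ i j : Fin 2,
      Tendsto (fun N => s N k i j) atTop (𝓝 (slim k i j))) (N : ℕ) :
    Tendsto (fun M => ‖pullback (ω (N + M)) (sdcLattice V σ hφ N M)
      - pullback ωlim (sdcCont V σ hφ N)‖) atTop (𝓝 0) := by
  choose S hS _ hk hq using hω
  obtain ⟨S', _, _, hk', hq'⟩ := hlim
  exact SDC.tendsto_norm_pullback (rgLattice_charge φ V σ hφ N) (rgCont_charge φ V σ hφ N)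
    (fun M => hq (N + M)) hq' (tendsto_twoPoint φ hS hk hk' hs N)

end Flow

end LatticeFermions

end

/-! ### Convergence of quasi-free states and of the lattice vacua. -/

theorem mainTheorem7 (V : Volume) (σ : ℤˣ) (φ : ScalingFunction) :
    -- quasi-free states of complex fermions
    (∀ (S : ∀ N, LatticeSpace V N →L[ℂ] LatticeSpace V N) (Slim : ContSpace V →L[ℂ] ContSpace V)
      (s : ℕ → ℝ → Matrix (Fin 2) (Fin 2) ℂ) (slim : ℝ → Matrix (Fin 2) (Fin 2) ℂ)
      (ω : ∀ N, CAR (LatticeSpace V N) →L[ℂ] ℂ) (ωlim : CAR (ContSpace V) →L[ℂ] ℂ),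
      (∀ N, IsUnitInterval (S N)) → IsUnitInterval Slim →
      (∀ N, LatticeKernel V σ N (S N) (s N)) → ContKernel V σ Slim slim →
      (∀ k ∈ contMomenta V σ, ∀ i j : Fin 2,
        Tendsto (fun N => s N k i j) atTop (𝓝 (slim k i j))) →
      (∀ N, CAR.IsQuasiFree (S N) (ω N)) → CAR.IsQuasiFree Slim ωlim →
      ∀ N, Tendsto (fun M => ‖pullback (ω (N + M)) (carLattice φ V σ N M)
        - pullback ωlim (carCont φ V σ N)‖) atTop (𝓝 0)) ∧
    -- quasi-free states of Majorana fermions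
    (∀ (hφ : φ.IsReal)
      (S : ∀ N, LatticeSpace V N →L[ℂ] LatticeSpace V N) (Slim : ContSpace V →L[ℂ] ContSpace V)
      (s : ℕ → ℝ → Matrix (Fin 2) (Fin 2) ℂ) (slim : ℝ → Matrix (Fin 2) (Fin 2) ℂ)
      (ω : ∀ N, SDC (latticeCharge V N) →L[ℂ] ℂ) (ωlim : SDC (contCharge V) →L[ℂ] ℂ),
      (∀ N, IsUnitInterval (S N)) → IsUnitInterval Slim →
      (∀ N, IsSelfDual (latticeCharge V N) (S N)) → IsSelfDual (contCharge V) Slim →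
      (∀ N, LatticeKernel V σ N (S N) (s N)) → ContKernel V σ Slim slim →
      (∀ k ∈ contMomenta V σ, ∀ i j : Fin 2,
        Tendsto (fun N => s N k i j) atTop (𝓝 (slim k i j))) →
      (∀ N, SDC.IsQuasiFree (latticeCharge V N) (S N) (ω N)) →
      SDC.IsQuasiFree (contCharge V) Slim ωlim →
      ∀ N, Tendsto (fun M => ‖pullback (ω (N + M)) (sdcLattice V σ hφ N M)
        - pullback ωlim (sdcCont V σ hφ N)‖) atTop (𝓝 0)) ∧
    -- lattice vacua
    (∀ (lam : ℕ → ℝ) (m : ℝ), (∀ N, 0 ≤ lam N) → 0 ≤ m →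
      Tendsto (fun N => (V.eps N)⁻¹ * lam N) atTop (𝓝 m) →
      (m = 0 → σ = 1 → ∀ᶠ N in atTop, lam N = 0) →
      -- Dirac mass, complex fermions
      (∀ (ω : ∀ N, CAR (LatticeSpace V N) →L[ℂ] ℂ) (ωlim : CAR (ContSpace V) →L[ℂ] ℂ),
        (∀ N, IsLatticeCARState V σ N (fun k => negativeEnergy
          (diracSymbol (V.eps N) (lam N) k) (diracDispersion (V.eps N) (lam N) k)) (ω N)) →
        IsContCARState V σ
          (fun k => negativeEnergy (diracSymbolCont m k) (contDispersion m k)) ωlim →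
        ∀ N, Tendsto (fun M => ‖pullback (ω (N + M)) (carLattice φ V σ N M)
          - pullback ωlim (carCont φ V σ N)‖) atTop (𝓝 0)) ∧
      -- Majorana mass, complex fermions
      (∀ (ω : ∀ N, CAR (LatticeSpace V N) →L[ℂ] ℂ) (ωlim : CAR (ContSpace V) →L[ℂ] ℂ),
        (∀ N, IsLatticeCARState V σ N (fun k => negativeEnergy
          (majoranaSymbol (V.eps N) (lam N) k) (majoranaDispersion (V.eps N) (lam N) k)) (ω N)) →
        IsContCARState V σ
          (fun k => negativeEnergy (majoranaSymbolCont m k) (contDispersion m k)) ωlim →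
        ∀ N, Tendsto (fun M => ‖pullback (ω (N + M)) (carLattice φ V σ N M)
          - pullback ωlim (carCont φ V σ N)‖) atTop (𝓝 0)) ∧
      -- Majorana mass, Majorana fermions
      (∀ (hφ : φ.IsReal)
        (ω : ∀ N, SDC (latticeCharge V N) →L[ℂ] ℂ) (ωlim : SDC (contCharge V) →L[ℂ] ℂ),
        (∀ N, IsLatticeSDCState V σ N (fun k => negativeEnergy
          (majoranaSymbol (V.eps N) (lam N) k) (majoranaDispersion (V.eps N) (lam N) k)) (ω N)) →
        IsContSDCState V σ
          (fun k => negativeEnergy (majoranaSymbolCont m k) (contDispersion m k)) ωlim →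
        ∀ N, Tendsto (fun M => ‖pullback (ω (N + M)) (sdcLattice V σ hφ N M)
          - pullback ωlim (sdcCont V σ hφ N)‖) atTop (𝓝 0))) := by
  refine ⟨fun S Slim s slim ω ωlim hS hSlim hk hklim hs hq hqlim => ?_,
    fun hφ S Slim s slim ω ωlim hS hSlim hC hClim hk hklim hs hq hqlim => ?_,
    fun lam m _ _ hlam hm => ⟨fun ω ωlim hω hlim => ?_, fun ω ωlim hω hlim => ?_,
      fun hφ ω ωlim hω hlim => ?_⟩⟩
  · exact tendsto_carFlow φ (fun N => ⟨S N, hS N, hk N, hq N⟩) ⟨Slim, hSlim, hklim, hqlim⟩ hs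
  · exact tendsto_sdcFlow hφ (fun N => ⟨S N, hS N, hC N, hk N, hq N⟩)
      ⟨Slim, hSlim, hClim, hklim, hqlim⟩ hs
  · exact tendsto_carFlow φ hω hlim (tendsto_vacuumKernel (tendsto_diracSymbol hlam)
      (tendsto_diracDispersion hlam) diracSymbol_zero diracSymbolCont_zero hm)
  · exact tendsto_carFlow φ hω hlim (tendsto_vacuumKernel (tendsto_majoranaSymbol hlam)
      (tendsto_majoranaDispersion hlam) majoranaSymbol_zero majoranaSymbolCont_zero hm)
  · exact tendsto_sdcFlow hφ hω hlim (tendsto_vacuumKernel (tendsto_majoranaSymbol hlam)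
      (tendsto_majoranaDispersion hlam) majoranaSymbol_zero majoranaSymbolCont_zero hm)
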